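/- Let $k$ be a perfect field. For a coalgebra $C$ (coassociative, counital) over $k$ with comultiplication $\Delta$, a right coideal is a subspace $N\subseteq C$ with $\Delta(N)\subseteq N\otimes C$, and $C$ is called a chain coalgebra if its right coideals are linearly ordered by inclusion. For a coalgebra $C$ and a $C$-bicomodule $M$ with left coaction $\rho^l$ and right coaction $\rho^r$, the cotensor product $M\,\Box_C\,N$ with a left $C$-comodule $(N,\lambda)$ is the kernel of $\rho^r\otimes \mathrm{id}_N-\mathrm{id}_M\otimes\lambda : M\otimes N\to M\otimes C\otimes N$. The cotensor coalgebra is $T_C(M)=\bigoplus_{n\ge 0}M^{\Box n}$, where $M^{\Box 0}=C$, $M^{\Box 1}=M$ and $M^{\Box (n+1)}=M\,\Box_C\, M^{\Box n}$ for $n\geq 1$. Its counit is that of $C$ on $M^{\Box 0}$ and zero on $M^{\Box n}$ for $n>0$. Its comultiplication is $\Delta_C$ on $C$, is $\rho^l+\rho^r$ on $M$, and for $n\ge 2$ is given on $M^{\Box n}$ by $$\Delta(m_1\Box\cdots\Box m_n)=\rho^l(m_1)\Box m_2\Box\cdots\Box m_n+\sum_{i=1}^{n-1}(m_1\Box\cdots\Box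 m_i)\otimes(m_{i+1}\Box\cdots\Box m_n)+m_1\Box\cdots\Box m_{n-1}\Box\rho^r(m_n).$$ For a finite-dimensional division algebra $D$ over $k$ and a $k$-algebra automorphism $\alpha\in\mathrm{Aut}_k(D)$, let $D_\alpha$ be the $D$-bimodule with underlying space $D$ and actions $a\rhd x=ax$, $x\lhd b=x\,\alpha(b)$. Let $D^*$ be the coalgebra dual to the algebra $D$, let $D_\alpha^*$ be the $D^*$-bicomodule dual to $D_\alpha$, and set $\mathcal{DC}(D,\alpha)=T_{D^*}(D_\alpha^*)$. Then for every infinite-dimensional chain coalgebra $C$ over $k$ there exist a finite-dimensional division algebra $D$ over $k$ and $\alpha\in\mathrm{Aut}_k(D)$ such that $C\cong\mathcal{DC}(D,\alpha)$ as coalgebras. -/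

import Mathlib

universe u v

namespace ChainCoalgebra

open scoped TensorProduct
open TensorProduct (assoc map)

section Chain

/-- A right coideal of `C`: a subspace `N` with `Δ(N) ⊆ N ⊗ C`, i.e. a right subcomodule. -/
def IsRightCoideal (k : Type u) {C : Type v} [Field k] [AddCommGroup C] [Module k C]
    [Coalgebra k C] (N : Submodule k C) : Prop :=
  ∀ x ∈ N, Coalgebra.comul (R := k) x ∈ LinearMap.range (N.subtype.rTensor C)

/-- A chain coalgebra: the right coideals are linearly ordered by inclusion. -/
def IsChainCoalgebra (k : Type u) (C : Type v) [Field k] [AddCommGroup C] [Module k C]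
    [Coalgebra k C] : Prop :=
  ∀ N N' : Submodule k C, IsRightCoideal k N → IsRightCoideal k N' → N ≤ N' ∨ N' ≤ N

end Chain

section Comodules

variable {k : Type u} [Field k]

/-- The cotensor product `M □_C N` of a right coaction `ρ` on `M` and a left coaction `l` on `N`:
the elements of `M ⊗ N` on which `ρ ⊗ id` and `id ⊗ l` agree. -/
def cotensor {C M N : Type v} [AddCommGroup C] [Module k C] [AddCommGroup M] [Module k M]
    [AddCommGroup N] [Module k N] (ρ : M →ₗ[k] M ⊗[k] C) (l : N →ₗ[k] C ⊗[k] N) :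
    Submodule k (M ⊗[k] N) :=
  LinearMap.eqLocus ((assoc k M C N).toLinearMap ∘ₗ ρ.rTensor N) (l.lTensor M)

/-- A (coassociative, counital) left `C`-comodule. -/
structure LeftComodule (k : Type u) (C : Type v) [Field k] [AddCommGroup C] [Module k C]
    [Coalgebra k C] where
  carrier : Type v
  [addCommGroup : AddCommGroup carrier]
  [module : Module k carrier]
  coact : carrier →ₗ[k] C ⊗[k] carrier
  coassoc : (assoc k C C carrier).toLinearMap ∘ₗ
    (Coalgebra.comul (R := k) (A := C)).rTensor carrier ∘ₗ coact = coact.lTensor C ∘ₗ coact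
  counit : (Coalgebra.counit (R := k) (A := C)).rTensor carrier ∘ₗ coact =
    TensorProduct.mk k k carrier 1

attribute [instance] LeftComodule.addCommGroup LeftComodule.module

/-- A `C`-bicomodule structure on the vector space `M`. -/
structure Bicomodule (k : Type u) (C M : Type v) [Field k] [AddCommGroup C] [Module k C]
    [Coalgebra k C] [AddCommGroup M] [Module k M] where
  left : M →ₗ[k] C ⊗[k] M
  right : M →ₗ[k] M ⊗[k] C
  left_coassoc : (assoc k C C M).toLinearMap ∘ₗ
    (Coalgebra.comul (R := k) (A := C)).rTensor M ∘ₗ left = left.lTensor C ∘ₗ left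
  left_counit : (Coalgebra.counit (R := k) (A := C)).rTensor M ∘ₗ left = TensorProduct.mk k k M 1
  right_coassoc : (assoc k M C C).toLinearMap ∘ₗ right.rTensor C ∘ₗ right =
    (Coalgebra.comul (R := k) (A := C)).lTensor M ∘ₗ right
  right_counit : (Coalgebra.counit (R := k) (A := C)).lTensor M ∘ₗ right =
    (TensorProduct.mk k M k).flip 1
  left_right : (assoc k C M C).toLinearMap ∘ₗ left.rTensor C ∘ₗ right = right.lTensor C ∘ₗ left

section Flat

variable {A B X Q : Type v} [AddCommGroup A] [Module k A] [AddCommGroup B] [Module k B]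
  [AddCommGroup X] [Module k X] [AddCommGroup Q] [Module k Q]

theorem lTensor_inj {Q : Type*} [AddCommGroup Q] [Module k Q] {f : A →ₗ[k] B}
    (hf : Function.Injective f) : Function.Injective (f.lTensor Q) :=
  Module.Flat.lTensor_preserves_injective_linearMap f hf

theorem rTensor_inj {Q : Type*} [AddCommGroup Q] [Module k Q] {f : A →ₗ[k] B}
    (hf : Function.Injective f) : Function.Injective (f.rTensor Q) :=
  Module.Flat.rTensor_preserves_injective_linearMap f hf

theorem mem_range_lTensor_eqLocus (f g : A →ₗ[k] B) (x : Q ⊗[k] A)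
    (h : f.lTensor Q x = g.lTensor Q x) :
    x ∈ LinearMap.range ((LinearMap.eqLocus f g).subtype.lTensor Q) := by
  have := Module.Flat.eqLocus_lTensor_eq (R := k) k Q f g
  have hx : x ∈ LinearMap.eqLocus (TensorProduct.AlgebraTensorModule.lTensor k Q f)
    (TensorProduct.AlgebraTensorModule.lTensor k Q g) := h
  rw [this] at hx
  exact hx

theorem mem_range_rTensor_eqLocus (f g : A →ₗ[k] B) (x : A ⊗[k] Q)
    (h : f.rTensor Q x = g.rTensor Q x) :
    x ∈ LinearMap.range ((LinearMap.eqLocus f g).subtype.rTensor Q) := by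
  have := mem_range_lTensor_eqLocus (Q := Q) f g (TensorProduct.comm k A Q x) (by
    rw [← LinearMap.comm_comp_rTensor_comp_comm_eq, ← LinearMap.comm_comp_rTensor_comp_comm_eq] 
    simp [h])
  obtain ⟨y, hy⟩ := this
  refine ⟨TensorProduct.comm k _ _ y, (TensorProduct.comm k A Q).injective ?_⟩
  rw [← hy, ← LinearMap.comm_comp_rTensor_comp_comm_eq]
  simp

end Flat

section CotensorMaps

variable {C M N N' Q : Type v} [AddCommGroup C] [Module k C]
  [AddCommGroup M] [Module k M] [AddCommGroup N] [Module k N] [AddCommGroup N'] [Module k N']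
  [AddCommGroup Q] [Module k Q]

theorem cotensorMap_aux (ρ : M →ₗ[k] M ⊗[k] C) (l : N →ₗ[k] C ⊗[k] N)
    (l' : N' →ₗ[k] C ⊗[k] N') (f : N →ₗ[k] N' ⊗[k] Q)
    (hf : (assoc k C N' Q).toLinearMap ∘ₗ l'.rTensor Q ∘ₗ f = f.lTensor C ∘ₗ l)
    (x : cotensor ρ l) :
    (assoc k M N' Q).symm (f.lTensor M x) ∈
      LinearMap.range ((cotensor ρ l').subtype.rTensor Q) := by
  obtain ⟨x, hx⟩ := x
  apply mem_range_rTensor_eqLocus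
  apply (assoc k M (C ⊗[k] N') Q).injective
  apply (LinearEquiv.lTensor M (assoc k C N' Q)).injective
  have h1 : ∀ y : M ⊗[k] N, (LinearEquiv.lTensor M (assoc k C N' Q))
      (assoc k M (C ⊗[k] N') Q
        ((((assoc k M C N').toLinearMap ∘ₗ ρ.rTensor N').rTensor Q)
          ((assoc k M N' Q).symm (f.lTensor M y)))) =
      (f.lTensor C).lTensor M (assoc k M C N (ρ.rTensor N y)) := by
    intro y
    induction y with
    | zero => simp
    | add a b ha hb => simp only [map_add, ha, hb]
    | tmul m n =>
      simp only [LinearMap.lTensor_tmul, LinearMap.rTensor_tmul]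
      have e1 : ∀ z : N' ⊗[k] Q, (LinearEquiv.lTensor M (assoc k C N' Q))
          (assoc k M (C ⊗[k] N') Q
            ((((assoc k M C N').toLinearMap ∘ₗ ρ.rTensor N').rTensor Q)
              ((assoc k M N' Q).symm (m ⊗ₜ z)))) = assoc k M C (N' ⊗[k] Q) (ρ m ⊗ₜ z) := by
        intro z
        induction z with
        | zero => simp
        | add a b ha hb => simp only [map_add, TensorProduct.tmul_add, ha, hb]
        | tmul a b =>
          simp only [TensorProduct.assoc_symm_tmul, LinearMap.rTensor_tmul, LinearMap.comp_apply]
          generalize ρ m = w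
          induction w with
          | zero => simp
          | add a b ha hb => simp only [map_add, TensorProduct.add_tmul, ha, hb]
          | tmul c d => simp
      rw [e1]
      generalize ρ m = w
      induction w with
      | zero => simp
      | add a b ha hb => simp only [map_add, TensorProduct.add_tmul, ha, hb]
      | tmul c d => simp
  have h2 : ∀ y : M ⊗[k] N, (LinearEquiv.lTensor M (assoc k C N' Q))
      (assoc k M (C ⊗[k] N') Q
        (((l'.lTensor M).rTensor Q) ((assoc k M N' Q).symm (f.lTensor M y)))) =
      ((assoc k C N' Q).toLinearMap ∘ₗ l'.rTensor Q ∘ₗ f).lTensor M y := by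
    intro y
    induction y with
    | zero => simp
    | add a b ha hb => simp only [map_add, ha, hb]
    | tmul m n =>
      simp only [LinearMap.lTensor_tmul, LinearMap.comp_apply]
      generalize f n = z
      induction z with
      | zero => simp
      | add a b ha hb => simp only [map_add, TensorProduct.tmul_add, ha, hb]
      | tmul a b => simp
  rw [h1, h2, hf]
  have hx' : (assoc k M C N) (ρ.rTensor N x) = l.lTensor M x := hx
  rw [hx', ← LinearMap.comp_apply, ← LinearMap.lTensor_comp]


/-- `id_M □ f : M □ N → (M □ N') ⊗ Q` for a left colinear map `f : N → N' ⊗ Q`. -/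
noncomputable def cotensorMap (ρ : M →ₗ[k] M ⊗[k] C) (l : N →ₗ[k] C ⊗[k] N)
    (l' : N' →ₗ[k] C ⊗[k] N') (f : N →ₗ[k] N' ⊗[k] Q)
    (hf : (assoc k C N' Q).toLinearMap ∘ₗ l'.rTensor Q ∘ₗ f = f.lTensor C ∘ₗ l) :
    cotensor ρ l →ₗ[k] cotensor ρ l' ⊗[k] Q :=
  LinearMap.codRestrictOfInjective
    ((assoc k M N' Q).symm.toLinearMap ∘ₗ f.lTensor M ∘ₗ (cotensor ρ l).subtype)
    ((cotensor ρ l').subtype.rTensor Q)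
    (rTensor_inj (Submodule.subtype_injective _)) (cotensorMap_aux ρ l l' f hf)

theorem subtype_cotensorMap (ρ : M →ₗ[k] M ⊗[k] C) (l : N →ₗ[k] C ⊗[k] N)
    (l' : N' →ₗ[k] C ⊗[k] N') (f : N →ₗ[k] N' ⊗[k] Q)
    (hf : (assoc k C N' Q).toLinearMap ∘ₗ l'.rTensor Q ∘ₗ f = f.lTensor C ∘ₗ l)
    (x : cotensor ρ l) :
    (cotensor ρ l').subtype.rTensor Q (cotensorMap ρ l l' f hf x) =
      (assoc k M N' Q).symm (f.lTensor M x) :=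
  LinearMap.codRestrictOfInjective_comp_apply _ _ _ _ x

variable [Coalgebra k C]

theorem cotensorCoact_aux (B : Bicomodule k C M) (l : N →ₗ[k] C ⊗[k] N)
    (x : cotensor B.right l) :
    assoc k C M N (B.left.rTensor N x) ∈
      LinearMap.range ((cotensor B.right l).subtype.lTensor C) := by
  obtain ⟨x, hx⟩ := x
  apply mem_range_lTensor_eqLocus
  have h1 : ∀ y : M ⊗[k] N, (((assoc k M C N).toLinearMap ∘ₗ B.right.rTensor N).lTensor C)
      (assoc k C M N (B.left.rTensor N y)) =
      (assoc k M C N).toLinearMap.lTensor C (assoc k C (M ⊗[k] C) N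
        ((B.right.lTensor C ∘ₗ B.left).rTensor N y)) := by
    intro y
    induction y with
    | zero => simp
    | add a b ha hb => simp only [map_add, ha, hb]
    | tmul m n =>
      simp only [LinearMap.rTensor_tmul, LinearMap.comp_apply]
      generalize B.left m = w
      induction w with
      | zero => simp
      | add a b ha hb => simp only [map_add, TensorProduct.add_tmul, ha, hb]
      | tmul c d => simp
  have h2 : ∀ y : M ⊗[k] N, (assoc k M C N).toLinearMap.lTensor C (assoc k C (M ⊗[k] C) N
        (((assoc k C M C).toLinearMap ∘ₗ B.left.rTensor C ∘ₗ B.right).rTensor N y)) =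
      assoc k C M (C ⊗[k] N) (B.left.rTensor (C ⊗[k] N) (assoc k M C N (B.right.rTensor N y))) := by
    intro y
    induction y with
    | zero => simp
    | add a b ha hb => simp only [map_add, ha, hb]
    | tmul m n =>
      simp only [LinearMap.rTensor_tmul, LinearMap.comp_apply]
      generalize B.right m = w
      induction w with
      | zero => simp
      | add a b ha hb => simp only [map_add, TensorProduct.add_tmul, ha, hb]
      | tmul c d =>
        simp only [LinearMap.rTensor_tmul, LinearEquiv.coe_coe, TensorProduct.assoc_tmul]
        generalize B.left c = w
        induction w with
        | zero => simp
        | add a b ha hb => simp only [map_add, TensorProduct.add_tmul, ha, hb]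
        | tmul c d => simp
  have h3 : ∀ y : M ⊗[k] N, assoc k C M (C ⊗[k] N) (B.left.rTensor (C ⊗[k] N) (l.lTensor M y)) =
      (l.lTensor M).lTensor C (assoc k C M N (B.left.rTensor N y)) := by
    intro y
    induction y with
    | zero => simp
    | add a b ha hb => simp only [map_add, ha, hb]
    | tmul m n =>
      simp only [LinearMap.rTensor_tmul, LinearMap.lTensor_tmul]
      generalize B.left m = w
      induction w with
      | zero => simp
      | add a b ha hb => simp only [map_add, TensorProduct.add_tmul, ha, hb]
      | tmul c d => simp
  have hx' : (assoc k M C N) (B.right.rTensor N x) = l.lTensor M x := hx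
  rw [← h3, ← hx', h1, ← B.left_right, h2]

/-- The left coaction of `C` on `M □ N` induced by the left coaction on `M`. -/
noncomputable def cotensorCoact (B : Bicomodule k C M) (l : N →ₗ[k] C ⊗[k] N) :
    cotensor B.right l →ₗ[k] C ⊗[k] cotensor B.right l :=
  LinearMap.codRestrictOfInjective
    ((assoc k C M N).toLinearMap ∘ₗ B.left.rTensor N ∘ₗ (cotensor B.right l).subtype)
    ((cotensor B.right l).subtype.lTensor C)
    (lTensor_inj (Submodule.subtype_injective _)) (cotensorCoact_aux B l)

theorem subtype_cotensorCoact (B : Bicomodule k C M) (l : N →ₗ[k] C ⊗[k] N)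
    (x : cotensor B.right l) :
    (cotensor B.right l).subtype.lTensor C (cotensorCoact B l x) =
      assoc k C M N (B.left.rTensor N x) :=
  LinearMap.codRestrictOfInjective_comp_apply _ _ _ _ x

theorem cotensorCoact_coassoc (B : Bicomodule k C M) (l : N →ₗ[k] C ⊗[k] N) :
    (assoc k C C (cotensor B.right l)).toLinearMap ∘ₗ
      (Coalgebra.comul (R := k) (A := C)).rTensor (cotensor B.right l) ∘ₗ cotensorCoact B l =
    (cotensorCoact B l).lTensor C ∘ₗ cotensorCoact B l := by
  ext x
  apply lTensor_inj (Q := C) (lTensor_inj (Q := C) (Submodule.subtype_injective _))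
  have h1 : ∀ y : C ⊗[k] cotensor B.right l,
      ((cotensor B.right l).subtype.lTensor C).lTensor C
        (assoc k C C (cotensor B.right l)
          ((Coalgebra.comul (R := k) (A := C)).rTensor (cotensor B.right l) y)) =
      assoc k C C (M ⊗[k] N) ((Coalgebra.comul (R := k) (A := C)).rTensor (M ⊗[k] N)
        ((cotensor B.right l).subtype.lTensor C y)) := by
    intro y
    induction y with
    | zero => simp
    | add a b ha hb => simp only [map_add, ha, hb]
    | tmul m n =>
      simp only [LinearMap.rTensor_tmul, LinearMap.lTensor_tmul]
      generalize Coalgebra.comul (R := k) (A := C) m = w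
      induction w with
      | zero => simp
      | add a b ha hb => simp only [map_add, TensorProduct.add_tmul, ha, hb]
      | tmul c d => simp
  have h2 : ∀ y : C ⊗[k] cotensor B.right l,
      ((cotensor B.right l).subtype.lTensor C).lTensor C ((cotensorCoact B l).lTensor C y) =
      ((assoc k C M N).toLinearMap ∘ₗ B.left.rTensor N).lTensor C
        ((cotensor B.right l).subtype.lTensor C y) := by
    intro y
    induction y with
    | zero => simp
    | add a b ha hb => simp only [map_add, ha, hb]
    | tmul m n =>
      simp only [LinearMap.lTensor_tmul, subtype_cotensorCoact]
      rfl
  have h3 : ∀ y : M ⊗[k] N, assoc k C C (M ⊗[k] N)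
      ((Coalgebra.comul (R := k) (A := C)).rTensor (M ⊗[k] N)
        (assoc k C M N (B.left.rTensor N y))) =
      (assoc k C M N).toLinearMap.lTensor C (assoc k C (C ⊗[k] M) N
        (((assoc k C C M).toLinearMap ∘ₗ (Coalgebra.comul (R := k) (A := C)).rTensor M ∘ₗ
          B.left).rTensor N y)) := by
    intro y
    induction y with
    | zero => simp
    | add a b ha hb => simp only [map_add, ha, hb]
    | tmul m n =>
      simp only [LinearMap.rTensor_tmul, LinearMap.comp_apply]
      generalize B.left m = w
      induction w with
      | zero => simp
      | add a b ha hb => simp only [map_add, TensorProduct.add_tmul, ha, hb]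
      | tmul c d =>
        simp only [LinearMap.rTensor_tmul, LinearEquiv.coe_coe, TensorProduct.assoc_tmul]
        generalize Coalgebra.comul (R := k) (A := C) c = w
        induction w with
        | zero => simp
        | add a b ha hb => simp only [map_add, TensorProduct.add_tmul, ha, hb]
        | tmul c d => simp
  have h4 : ∀ y : M ⊗[k] N, ((assoc k C M N).toLinearMap ∘ₗ B.left.rTensor N).lTensor C
        (assoc k C M N (B.left.rTensor N y)) =
      (assoc k C M N).toLinearMap.lTensor C (assoc k C (C ⊗[k] M) N
        ((B.left.lTensor C ∘ₗ B.left).rTensor N y)) := by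
    intro y
    induction y with
    | zero => simp
    | add a b ha hb => simp only [map_add, ha, hb]
    | tmul m n =>
      simp only [LinearMap.rTensor_tmul, LinearMap.comp_apply]
      generalize B.left m = w
      induction w with
      | zero => simp
      | add a b ha hb => simp only [map_add, TensorProduct.add_tmul, ha, hb]
      | tmul c d => simp
  simp only [LinearMap.comp_apply, LinearEquiv.coe_coe]
  rw [h1, h2, subtype_cotensorCoact, h3, h4, B.left_coassoc]

theorem cotensorCoact_counit (B : Bicomodule k C M) (l : N →ₗ[k] C ⊗[k] N) :
    (Coalgebra.counit (R := k) (A := C)).rTensor (cotensor B.right l) ∘ₗ cotensorCoact B l =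
    TensorProduct.mk k k (cotensor B.right l) 1 := by
  ext x
  apply lTensor_inj (Q := k) (Submodule.subtype_injective (cotensor B.right l))
  have h1 : ∀ y : C ⊗[k] cotensor B.right l,
      (cotensor B.right l).subtype.lTensor k
          ((Coalgebra.counit (R := k) (A := C)).rTensor (cotensor B.right l) y) =
      (Coalgebra.counit (R := k) (A := C)).rTensor (M ⊗[k] N)
        ((cotensor B.right l).subtype.lTensor C y) := by
    intro y
    rw [← LinearMap.comp_apply, ← LinearMap.comp_apply, LinearMap.lTensor_comp_rTensor,
      LinearMap.rTensor_comp_lTensor]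
  have h3 : ∀ y : M ⊗[k] N, (Coalgebra.counit (R := k) (A := C)).rTensor (M ⊗[k] N)
        (assoc k C M N (B.left.rTensor N y)) =
      assoc k k M N
        (((Coalgebra.counit (R := k) (A := C)).rTensor M ∘ₗ B.left).rTensor N y) := by
    intro y
    induction y with
    | zero => simp
    | add a b ha hb => simp only [map_add, ha, hb]
    | tmul m n =>
      simp only [LinearMap.rTensor_tmul, LinearMap.comp_apply]
      generalize B.left m = w
      induction w with
      | zero => simp
      | add a b ha hb => simp only [map_add, TensorProduct.add_tmul, ha, hb]
      | tmul c d => simp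
  have h4 : ∀ y : M ⊗[k] N, assoc k k M N ((TensorProduct.mk k k M 1).rTensor N y) =
      (1 : k) ⊗ₜ[k] y := by
    intro y
    induction y with
    | zero => simp
    | add a b ha hb => simp only [map_add, TensorProduct.tmul_add, ha, hb]
    | tmul m n => simp
  simp only [LinearMap.comp_apply]
  rw [h1, subtype_cotensorCoact, h3, B.left_counit, h4]
  simp

/-- `id_M □ f` is again left colinear. -/
theorem cotensorMap_colinear (B : Bicomodule k C M) (l : N →ₗ[k] C ⊗[k] N)
    (l' : N' →ₗ[k] C ⊗[k] N') (f : N →ₗ[k] N' ⊗[k] Q)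
    (hf : (assoc k C N' Q).toLinearMap ∘ₗ l'.rTensor Q ∘ₗ f = f.lTensor C ∘ₗ l) :
    (assoc k C (cotensor B.right l') Q).toLinearMap ∘ₗ (cotensorCoact B l').rTensor Q ∘ₗ
      cotensorMap B.right l l' f hf =
    (cotensorMap B.right l l' f hf).lTensor C ∘ₗ cotensorCoact B l := by
  ext x
  apply lTensor_inj (Q := C) (rTensor_inj (Q := Q) (Submodule.subtype_injective _))
  have h1 : ∀ y : cotensor B.right l' ⊗[k] Q,
      ((cotensor B.right l').subtype.rTensor Q).lTensor C
        (assoc k C (cotensor B.right l') Q ((cotensorCoact B l').rTensor Q y)) =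
      assoc k C (M ⊗[k] N') Q (((assoc k C M N').toLinearMap ∘ₗ B.left.rTensor N').rTensor Q
        ((cotensor B.right l').subtype.rTensor Q y)) := by
    intro y
    induction y with
    | zero => simp
    | add a b ha hb => simp only [map_add, ha, hb]
    | tmul m n =>
      simp only [LinearMap.rTensor_tmul, LinearMap.comp_apply, Submodule.subtype_apply,
        LinearEquiv.coe_coe]
      rw [← subtype_cotensorCoact B l' m]
      generalize cotensorCoact B l' m = w
      induction w with
      | zero => simp
      | add a b ha hb => simp only [map_add, TensorProduct.add_tmul, ha, hb]
      | tmul c d => simp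
  have h2 : ∀ y : C ⊗[k] cotensor B.right l,
      ((cotensor B.right l').subtype.rTensor Q).lTensor C
        ((cotensorMap B.right l l' f hf).lTensor C y) =
      ((assoc k M N' Q).symm.toLinearMap ∘ₗ f.lTensor M).lTensor C
        ((cotensor B.right l).subtype.lTensor C y) := by
    intro y
    induction y with
    | zero => simp
    | add a b ha hb => simp only [map_add, ha, hb]
    | tmul m n =>
      simp only [LinearMap.lTensor_tmul, subtype_cotensorMap]
      rfl
  have h3 : ∀ y : M ⊗[k] N,
      assoc k C (M ⊗[k] N') Q (((assoc k C M N').toLinearMap ∘ₗ B.left.rTensor N').rTensor Q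
        ((assoc k M N' Q).symm (f.lTensor M y))) =
      ((assoc k M N' Q).symm.toLinearMap ∘ₗ f.lTensor M).lTensor C
        (assoc k C M N (B.left.rTensor N y)) := by
    intro y
    induction y with
    | zero => simp
    | add a b ha hb => simp only [map_add, ha, hb]
    | tmul m n =>
      have e1 : ∀ z : N' ⊗[k] Q,
          assoc k C (M ⊗[k] N') Q (((assoc k C M N').toLinearMap ∘ₗ B.left.rTensor N').rTensor Q
            ((assoc k M N' Q).symm (m ⊗ₜ z))) =
          (assoc k M N' Q).symm.toLinearMap.lTensor C (assoc k C M (N' ⊗[k] Q)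
            (B.left m ⊗ₜ z)) := by
        intro z
        induction z with
        | zero => simp
        | add a b ha hb => simp only [map_add, TensorProduct.tmul_add, ha, hb]
        | tmul a b =>
          simp only [TensorProduct.assoc_symm_tmul, LinearMap.rTensor_tmul, LinearMap.comp_apply]
          generalize B.left m = w
          induction w with
          | zero => simp
          | add a b ha hb => simp only [map_add, TensorProduct.add_tmul, ha, hb]
          | tmul c d => simp
      simp only [LinearMap.rTensor_tmul, LinearMap.lTensor_tmul, e1]
      generalize B.left m = w
      induction w with
      | zero => simp
      | add a b ha hb => simp only [map_add, TensorProduct.add_tmul, ha, hb]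
      | tmul c d => simp
  simp only [LinearMap.comp_apply, LinearEquiv.coe_coe]
  rw [h1, h2, subtype_cotensorCoact, subtype_cotensorMap, h3]

end CotensorMaps

section Steps

variable {M A A' X X' J L R : Type v} [AddCommGroup M] [Module k M] [AddCommGroup A] [Module k A]
  [AddCommGroup A'] [Module k A'] [AddCommGroup X] [Module k X] [AddCommGroup X'] [Module k X']
  [AddCommGroup J] [Module k J] [AddCommGroup L] [Module k L] [AddCommGroup R] [Module k R]

theorem coassoc_step_left (S : A →ₗ[k] M ⊗[k] X) (T : A' →ₗ[k] M ⊗[k] X') (F : A →ₗ[k] A' ⊗[k] J)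
    (f : X →ₗ[k] X' ⊗[k] J)
    (h : ∀ a, T.rTensor J (F a) = (assoc k M X' J).symm (f.lTensor M (S a))) (u : A ⊗[k] L) :
    assoc k M X' (J ⊗[k] L) (T.rTensor (J ⊗[k] L) (assoc k A' J L (F.rTensor L u))) =
      ((assoc k X' J L).toLinearMap ∘ₗ f.rTensor L).lTensor M (assoc k M X L (S.rTensor L u)) := by
  induction u with
  | zero => simp
  | add a b ha hb => simp only [map_add, ha, hb]
  | tmul a b =>
    have e1 : ∀ w : A' ⊗[k] J,
        assoc k M X' (J ⊗[k] L) (T.rTensor (J ⊗[k] L) (assoc k A' J L (w ⊗ₜ b))) =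
        (assoc k X' J L).toLinearMap.lTensor M (assoc k M (X' ⊗[k] J) L
          ((assoc k M X' J (T.rTensor J w)) ⊗ₜ b)) := by
      intro w
      induction w with
      | zero => simp
      | add a b ha hb => simp only [map_add, TensorProduct.add_tmul, ha, hb]
      | tmul c d =>
        simp only [LinearMap.rTensor_tmul, TensorProduct.assoc_tmul]
        generalize T c = z
        induction z with
        | zero => simp
        | add a b ha hb => simp only [map_add, TensorProduct.add_tmul, ha, hb]
        | tmul c d => simp
    simp only [LinearMap.rTensor_tmul]
    rw [e1, h, LinearEquiv.apply_symm_apply]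
    generalize S a = z
    induction z with
    | zero => simp
    | add a b ha hb => simp only [map_add, TensorProduct.add_tmul, ha, hb]
    | tmul c d => simp

theorem coassoc_step_right (T : A' →ₗ[k] M ⊗[k] X') (g : R →ₗ[k] J ⊗[k] L) (w : A' ⊗[k] R) :
    assoc k M X' (J ⊗[k] L) (T.rTensor (J ⊗[k] L) (g.lTensor A' w)) =
      (g.lTensor X').lTensor M (assoc k M X' R (T.rTensor R w)) := by
  induction w with
  | zero => simp
  | add a b ha hb => simp only [map_add, ha, hb]
  | tmul a b =>
    simp only [LinearMap.rTensor_tmul, LinearMap.lTensor_tmul]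
    generalize T a = z
    induction z with
    | zero => simp
    | add a b ha hb => simp only [map_add, TensorProduct.add_tmul, ha, hb]
    | tmul c d => simp

end Steps

section Powers

variable {C M : Type v} [AddCommGroup C] [Module k C] [Coalgebra k C]
  [AddCommGroup M] [Module k M]

/-- The left comodule `M □_C N` of a bicomodule `M` and a left comodule `N`. -/
noncomputable def Bicomodule.cotensor (B : Bicomodule k C M) (N : LeftComodule k C) :
    LeftComodule k C where
  carrier := ChainCoalgebra.cotensor B.right N.coact
  coact := cotensorCoact B N.coact
  coassoc := cotensorCoact_coassoc B N.coact
  counit := cotensorCoact_counit B N.coact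

/-- The cotensor powers `M^{□ n}`, with their left coactions: `M^{□ 0} = C`, `M^{□ 1} = M` and
`M^{□ (n + 2)} = M □ M^{□ (n + 1)}`. -/
noncomputable def Bicomodule.power (B : Bicomodule k C M) : ℕ → LeftComodule k C
  | 0 => ⟨C, Coalgebra.comul, Coalgebra.coassoc, Coalgebra.rTensor_counit_comp_comul⟩
  | 1 => ⟨M, B.left, B.left_coassoc, B.left_counit⟩
  | n + 2 => B.cotensor (B.power (n + 1))

/-- The component `M^{□ (i + j)} → M^{□ i} ⊗ M^{□ j}` of the comultiplication, together with the
fact that it is left colinear. It is the left coaction for `i = 0`, the right coaction for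
`(i, j) = (1, 0)`, the inclusion for `i = 1` and `j > 0`, and `id_M □ Δ_{i - 1, j}` for `i > 1`. -/
noncomputable def Bicomodule.split (B : Bicomodule k C M) : (i j : ℕ) →
    {f : (B.power (j + i)).carrier →ₗ[k] (B.power i).carrier ⊗[k] (B.power j).carrier //
      (assoc k C (B.power i).carrier (B.power j).carrier).toLinearMap ∘ₗ
        (B.power i).coact.rTensor (B.power j).carrier ∘ₗ f =
      f.lTensor C ∘ₗ (B.power (j + i)).coact}
  | 0, j => ⟨(B.power j).coact, (B.power j).coassoc⟩
  | 1, 0 => ⟨B.right, B.left_right⟩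
  | 1, j + 1 => ⟨(ChainCoalgebra.cotensor B.right (B.power (j + 1)).coact).subtype, by
      ext x; exact (subtype_cotensorCoact B (B.power (j + 1)).coact x).symm⟩
  | i + 2, j =>
      ⟨cotensorMap B.right (B.power (j + (i + 1))).coact (B.power (i + 1)).coact
        (B.split (i + 1) j).1 (B.split (i + 1) j).2,
       cotensorMap_colinear B (B.power (j + (i + 1))).coact (B.power (i + 1)).coact
        (B.split (i + 1) j).1 (B.split (i + 1) j).2⟩


/-- The component `M^{□ n} → M^{□ i} ⊗ M^{□ j}` of the comultiplication (zero unless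
`n = i + j`). -/
noncomputable def Bicomodule.part (B : Bicomodule k C M) (i j n : ℕ) :
    (B.power n).carrier →ₗ[k] (B.power i).carrier ⊗[k] (B.power j).carrier :=
  (B.split i j).1 ∘ₗ DirectSum.component k ℕ (fun m => (B.power m).carrier) (j + i) ∘ₗ
    DirectSum.lof k ℕ (fun m => (B.power m).carrier) n

theorem Bicomodule.part_self (B : Bicomodule k C M) (i j : ℕ) :
    B.part i j (j + i) = (B.split i j).1 := by
  ext x
  simp only [Bicomodule.part, LinearMap.comp_apply, DirectSum.component.lof_self]

theorem Bicomodule.part_succ (B : Bicomodule k C M) (i j n : ℕ) (h : j + i = n)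
    (x : (B.power (n + 2)).carrier) :
    (ChainCoalgebra.cotensor B.right (B.power (i + 1)).coact).subtype.rTensor
        (B.power j).carrier (B.part (i + 2) j (n + 2) x) =
      (assoc k M (B.power (i + 1)).carrier (B.power j).carrier).symm
        ((B.part (i + 1) j (n + 1)).lTensor M
          ((ChainCoalgebra.cotensor B.right (B.power (n + 1)).coact).subtype x)) := by
  subst h
  have h1 : B.part (i + 2) j (j + i + 2) = (B.split (i + 2) j).1 := B.part_self (i + 2) j
  have h2 : B.part (i + 1) j (j + i + 1) = (B.split (i + 1) j).1 := B.part_self (i + 1) j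
  rw [h1, h2]
  exact subtype_cotensorMap B.right (B.power (j + (i + 1))).coact (B.power (i + 1)).coact
        (B.split (i + 1) j).1 (B.split (i + 1) j).2 x

theorem Bicomodule.part_coassoc (B : Bicomodule k C M) (i j l m r n : ℕ) (h1 : j + i = m)
    (h2 : l + m = n) (h3 : l + j = r) (h4 : r + i = n) :
    (assoc k (B.power i).carrier (B.power j).carrier (B.power l).carrier).toLinearMap ∘ₗ
      (B.part i j m).rTensor (B.power l).carrier ∘ₗ B.part m l n =
    (B.part j l r).lTensor (B.power i).carrier ∘ₗ B.part i r n := by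
  induction i generalizing m r n with
  | zero =>
    obtain rfl : j = m := h1
    obtain rfl : r = n := h4
    subst h3
    have e1 : B.part 0 j j = (B.power j).coact := B.part_self 0 j
    have e2 : B.part 0 (l + j) (l + j) = (B.power (l + j)).coact := B.part_self 0 (l + j)
    rw [e1, e2, B.part_self]
    exact (B.split j l).2
  | succ i ih =>
    cases i with
    | zero =>
      cases j with
      | zero =>
        obtain rfl : 1 = m := by omega
        obtain rfl : l = r := by omega
        subst h2
        have e1 : B.part 1 0 1 = B.right := B.part_self 1 0
        have e2 : B.part 0 l l = (B.power l).coact := B.part_self 0 l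
        rw [e1, e2]
        cases l with
        | zero =>
          have e3 : B.part 1 0 (0 + 1) = B.right := B.part_self 1 0
          rw [e3]
          exact B.right_coassoc
        | succ l =>
          have e3 : B.part 1 (l + 1) (l + 1 + 1) =
            (ChainCoalgebra.cotensor B.right (B.power (l + 1)).coact).subtype :=
            B.part_self 1 (l + 1)
          rw [e3]
          ext x
          exact x.2
      | succ j =>
        obtain rfl : j + 2 = m := by omega
        subst h3
        obtain rfl : l + j + 2 = n := by omega
        have e1 : B.part 1 (j + 1) (j + 2) =
            (ChainCoalgebra.cotensor B.right (B.power (j + 1)).coact).subtype :=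
          B.part_self 1 (j + 1)
        have e2 : B.part 1 (l + (j + 1)) (l + j + 2) =
            (ChainCoalgebra.cotensor B.right (B.power (l + j + 1)).coact).subtype :=
          B.part_self 1 (l + j + 1)
        ext x
        have := B.part_succ j l (l + j) rfl x
        rw [LinearEquiv.eq_symm_apply] at this
        simp only [e1, e2]
        exact this
    | succ i =>
      obtain ⟨m, rfl⟩ : ∃ m', m = m' + 2 := ⟨m - 2, by omega⟩
      obtain ⟨n, rfl⟩ : ∃ n', n = n' + 2 := ⟨n - 2, by omega⟩
      have ih' := ih (m + 1) r (n + 1) (by omega) (by omega) h3 (by omega)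
      ext x
      apply rTensor_inj (Q := (B.power j).carrier ⊗[k] (B.power l).carrier)
        (Submodule.subtype_injective
          (ChainCoalgebra.cotensor B.right (B.power (i + 1)).coact))
      apply (assoc k M (B.power (i + 1)).carrier
        ((B.power j).carrier ⊗[k] (B.power l).carrier)).injective
      have e1 := coassoc_step_left (L := (B.power l).carrier)
        (ChainCoalgebra.cotensor B.right (B.power (m + 1)).coact).subtype
        (ChainCoalgebra.cotensor B.right (B.power (i + 1)).coact).subtype
        (B.part (i + 2) j (m + 2)) (B.part (i + 1) j (m + 1))
        (fun a => B.part_succ i j m (by omega) a) (B.part (m + 2) l (n + 2) x)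
      have e2 := coassoc_step_right
        (ChainCoalgebra.cotensor B.right (B.power (i + 1)).coact).subtype (B.part j l r)
        (B.part (i + 2) r (n + 2) x)
      refine e1.trans (Eq.trans ?_ e2.symm)
      rw [B.part_succ m l n (by omega), B.part_succ i r n (by omega),
        LinearEquiv.apply_symm_apply, LinearEquiv.apply_symm_apply,
        ← LinearMap.comp_apply, ← LinearMap.lTensor_comp, LinearMap.comp_assoc, ih',
        LinearMap.lTensor_comp, LinearMap.comp_apply]

/-- The counit of `C`, on `M^{□ 0} = C`. -/
noncomputable def Bicomodule.counitZero (B : Bicomodule k C M) : (B.power 0).carrier →ₗ[k] k :=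
  Coalgebra.counit (R := k) (A := C)

theorem Bicomodule.part_counit_left (B : Bicomodule k C M) (n : ℕ) :
    B.counitZero.rTensor (B.power n).carrier ∘ₗ B.part 0 n n =
      TensorProduct.mk k k (B.power n).carrier 1 := by
  have e1 : B.part 0 n n = (B.power n).coact := B.part_self 0 n
  rw [e1]
  exact (B.power n).counit

theorem Bicomodule.part_counit_right (B : Bicomodule k C M) (n : ℕ) :
    B.counitZero.lTensor (B.power n).carrier ∘ₗ B.part n 0 n =
      (TensorProduct.mk k (B.power n).carrier k).flip 1 := by
  induction n with
  | zero =>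
    have e1 : B.part 0 0 0 = Coalgebra.comul (R := k) (A := C) := B.part_self 0 0
    rw [e1]
    exact Coalgebra.lTensor_counit_comp_comul (R := k) (A := C)
  | succ n ih =>
    cases n with
    | zero =>
      have e1 : B.part 1 0 1 = B.right := B.part_self 1 0
      rw [e1]
      exact B.right_counit
    | succ n =>
      ext x
      apply rTensor_inj (Q := k) (Submodule.subtype_injective
          (ChainCoalgebra.cotensor B.right (B.power (n + 1)).coact))
      have h1 : ∀ y : ChainCoalgebra.cotensor B.right (B.power (n + 1)).coact ⊗[k]
            (B.power 0).carrier,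
          (ChainCoalgebra.cotensor B.right (B.power (n + 1)).coact).subtype.rTensor k
            (B.counitZero.lTensor _ y) =
          B.counitZero.lTensor _
            ((ChainCoalgebra.cotensor B.right (B.power (n + 1)).coact).subtype.rTensor
              (B.power 0).carrier y) := by
        intro y
        rw [← LinearMap.comp_apply, ← LinearMap.comp_apply, LinearMap.lTensor_comp_rTensor,
          LinearMap.rTensor_comp_lTensor]
      have h2 : ∀ y : M ⊗[k] ((B.power (n + 1)).carrier ⊗[k] (B.power 0).carrier),
          B.counitZero.lTensor (M ⊗[k] (B.power (n + 1)).carrier)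
            ((assoc k M (B.power (n + 1)).carrier (B.power 0).carrier).symm y) =
          (assoc k M (B.power (n + 1)).carrier k).symm
            ((B.counitZero.lTensor (B.power (n + 1)).carrier).lTensor M y) := by
        intro y
        rw [LinearEquiv.eq_symm_apply]
        induction y with
        | zero => simp
        | add a b ha hb => simp only [map_add, ha, hb]
        | tmul a b =>
          induction b with
          | zero => simp
          | add a b ha hb => simp only [map_add, TensorProduct.tmul_add, ha, hb]
          | tmul c d => simp
      have h3 : ∀ y : M ⊗[k] (B.power (n + 1)).carrier,
          (assoc k M (B.power (n + 1)).carrier k).symm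
            (((TensorProduct.mk k (B.power (n + 1)).carrier k).flip 1).lTensor M y) =
          y ⊗ₜ[k] (1 : k) := by
        intro y
        induction y with
        | zero => simp
        | add a b ha hb => simp only [map_add, TensorProduct.add_tmul, ha, hb]
        | tmul a b => simp
      have h4 : ∀ y : M ⊗[k] (B.power (n + 1)).carrier,
          (B.counitZero.lTensor (B.power (n + 1)).carrier).lTensor M
            ((B.part (n + 1) 0 (n + 1)).lTensor M y) =
          ((TensorProduct.mk k (B.power (n + 1)).carrier k).flip 1).lTensor M y := by
        intro y
        rw [← LinearMap.comp_apply, ← LinearMap.lTensor_comp, ih]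
      refine (h1 _).trans ?_
      refine (congrArg _ (B.part_succ n 0 n (by omega) x)).trans ?_
      refine (h2 _).trans ?_
      exact (congrArg _ (h4 _)).trans (h3 _)

/-- The cotensor coalgebra `T_C(M) = ⨁ₙ M^{□ n}`. -/
def CotensorCoalgebra (B : Bicomodule k C M) : Type v :=
  DirectSum ℕ (fun n => (B.power n).carrier)

namespace CotensorCoalgebra

variable (B : Bicomodule k C M)

noncomputable instance : AddCommGroup (CotensorCoalgebra B) :=
  inferInstanceAs (AddCommGroup (DirectSum ℕ (fun n => (B.power n).carrier)))

noncomputable instance : Module k (CotensorCoalgebra B) :=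
  inferInstanceAs (Module k (DirectSum ℕ (fun n => (B.power n).carrier)))

/-- The inclusion of the `n`-th cotensor power. -/
noncomputable def ι (n : ℕ) : (B.power n).carrier →ₗ[k] CotensorCoalgebra B :=
  DirectSum.lof k ℕ (fun m => (B.power m).carrier) n

variable {B} in
theorem hom_ext {X : Type*} [AddCommGroup X] [Module k X] {f g : CotensorCoalgebra B →ₗ[k] X}
    (h : ∀ n, f ∘ₗ ι B n = g ∘ₗ ι B n) : f = g :=
  DirectSum.linearMap_ext k h

/-- On `M^{□ n}` the comultiplication is the sum over `i + j = n` of its components in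
`M^{□ i} ⊗ M^{□ j}`, and the counit is that of `C` on `M^{□ 0} = C` and zero on `M^{□ n}`,
`n > 0`. -/
noncomputable instance : CoalgebraStruct k (CotensorCoalgebra B) where
  comul := DirectSum.toModule k ℕ _ fun n =>
    ∑ p ∈ Finset.HasAntidiagonal.antidiagonal n, map (ι B p.1) (ι B p.2) ∘ₗ B.part p.1 p.2 n
  counit := B.counitZero ∘ₗ
    DirectSum.component k ℕ (fun m => (B.power m).carrier) 0

theorem comul_ι (n : ℕ) (x : (B.power n).carrier) :
    CoalgebraStruct.comul (R := k) (ι B n x) =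
      ∑ p ∈ Finset.HasAntidiagonal.antidiagonal n, map (ι B p.1) (ι B p.2) (B.part p.1 p.2 n x) := by
  refine (DirectSum.toModule_lof (M := fun m => (B.power m).carrier) k n x).trans ?_
  simp [LinearMap.sum_apply]

theorem counit_ι_zero (x : (B.power 0).carrier) :
    CoalgebraStruct.counit (R := k) (ι B 0 x) = B.counitZero x :=
  congrArg B.counitZero
    (DirectSum.component.lof_self k (M := fun m => (B.power m).carrier) 0 x)

theorem counit_ι_of_ne (n : ℕ) (hn : n ≠ 0) (x : (B.power n).carrier) :
    CoalgebraStruct.counit (R := k) (ι B n x) = 0 := by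
  have : DirectSum.component k ℕ (fun m => (B.power m).carrier) 0
      (DirectSum.lof k ℕ (fun m => (B.power m).carrier) n x) = 0 := by
    rw [DirectSum.component.of, dif_neg hn]
  exact (congrArg B.counitZero this).trans
    (map_zero B.counitZero)

theorem rTensor_comul_ι (m l : ℕ) (z : (B.power m).carrier ⊗[k] (B.power l).carrier) :
    (CoalgebraStruct.comul (R := k) (A := CotensorCoalgebra B)).rTensor (CotensorCoalgebra B)
        (map (ι B m) (ι B l) z) =
      ∑ p ∈ Finset.HasAntidiagonal.antidiagonal m, map (map (ι B p.1) (ι B p.2)) (ι B l)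
        ((B.part p.1 p.2 m).rTensor (B.power l).carrier z) := by
  induction z with
  | zero => simp
  | add a b ha hb => simp only [map_add, ha, hb, Finset.sum_add_distrib]
  | tmul a b =>
    simp only [TensorProduct.map_tmul, LinearMap.rTensor_tmul, comul_ι, TensorProduct.sum_tmul]

theorem lTensor_comul_ι (m l : ℕ) (z : (B.power m).carrier ⊗[k] (B.power l).carrier) :
    (CoalgebraStruct.comul (R := k) (A := CotensorCoalgebra B)).lTensor (CotensorCoalgebra B)
        (map (ι B m) (ι B l) z) =
      ∑ p ∈ Finset.HasAntidiagonal.antidiagonal l, map (ι B m) (map (ι B p.1) (ι B p.2))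
        ((B.part p.1 p.2 l).lTensor (B.power m).carrier z) := by
  induction z with
  | zero => simp
  | add a b ha hb => simp only [map_add, ha, hb, Finset.sum_add_distrib]
  | tmul a b =>
    simp only [TensorProduct.map_tmul, LinearMap.lTensor_tmul, comul_ι, TensorProduct.tmul_sum]

theorem rTensor_counit_ι_zero (l : ℕ) (z : (B.power 0).carrier ⊗[k] (B.power l).carrier) :
    (CoalgebraStruct.counit (R := k) (A := CotensorCoalgebra B)).rTensor (CotensorCoalgebra B)
        (map (ι B 0) (ι B l) z) =
      (ι B l).lTensor k (B.counitZero.rTensor (B.power l).carrier z) := by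
  induction z with
  | zero => simp
  | add a b ha hb => simp only [map_add, ha, hb]
  | tmul a b =>
    simp only [TensorProduct.map_tmul, LinearMap.rTensor_tmul, LinearMap.lTensor_tmul,
      counit_ι_zero]

theorem rTensor_counit_ι_of_ne (m l : ℕ) (hm : m ≠ 0)
    (z : (B.power m).carrier ⊗[k] (B.power l).carrier) :
    (CoalgebraStruct.counit (R := k) (A := CotensorCoalgebra B)).rTensor (CotensorCoalgebra B)
        (map (ι B m) (ι B l) z) = 0 := by
  induction z with
  | zero => simp
  | add a b ha hb => simp only [map_add, ha, hb, add_zero]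
  | tmul a b => simp [counit_ι_of_ne B m hm]

theorem lTensor_counit_ι_zero (m : ℕ) (z : (B.power m).carrier ⊗[k] (B.power 0).carrier) :
    (CoalgebraStruct.counit (R := k) (A := CotensorCoalgebra B)).lTensor (CotensorCoalgebra B)
        (map (ι B m) (ι B 0) z) =
      (ι B m).rTensor k (B.counitZero.lTensor (B.power m).carrier z) := by
  induction z with
  | zero => simp
  | add a b ha hb => simp only [map_add, ha, hb]
  | tmul a b =>
    simp only [TensorProduct.map_tmul, LinearMap.rTensor_tmul, LinearMap.lTensor_tmul,
      counit_ι_zero]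

theorem lTensor_counit_ι_of_ne (m l : ℕ) (hl : l ≠ 0)
    (z : (B.power m).carrier ⊗[k] (B.power l).carrier) :
    (CoalgebraStruct.counit (R := k) (A := CotensorCoalgebra B)).lTensor (CotensorCoalgebra B)
        (map (ι B m) (ι B l) z) = 0 := by
  induction z with
  | zero => simp
  | add a b ha hb => simp only [map_add, ha, hb, add_zero]
  | tmul a b => simp [counit_ι_of_ne B l hl]

noncomputable instance : Coalgebra k (CotensorCoalgebra B) where
  coassoc := by
    refine hom_ext fun n => LinearMap.ext fun x => ?_
    simp only [LinearMap.comp_apply, LinearEquiv.coe_coe, comul_ι, map_sum, rTensor_comul_ι,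
      lTensor_comul_ι, ← TensorProduct.map_map_assoc]
    rw [Finset.sum_sigma', Finset.sum_sigma']
    refine Finset.sum_nbij' (fun ⟨⟨_, l⟩, ⟨i, j⟩⟩ => ⟨(i, j + l), (j, l)⟩)
      (fun ⟨⟨i, _⟩, ⟨j, l⟩⟩ => ⟨(i + j, l), (i, j)⟩) ?_ ?_ ?_ ?_ ?_
    · rintro ⟨⟨a, b⟩, ⟨c, d⟩⟩ h
      simp at h ⊢
      omega
    · rintro ⟨⟨a, b⟩, ⟨c, d⟩⟩ h
      simp at h ⊢
      omega
    · rintro ⟨⟨a, b⟩, ⟨c, d⟩⟩ h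
      simp at h ⊢
      exact h.2
    · rintro ⟨⟨a, b⟩, ⟨c, d⟩⟩ h
      simp at h ⊢
      exact h.2
    · rintro ⟨⟨m, l⟩, ⟨i, j⟩⟩ h
      simp only [Finset.mem_sigma, Finset.HasAntidiagonal.mem_antidiagonal] at h
      have := LinearMap.congr_fun (B.part_coassoc i j l m (j + l) n (by omega) (by omega)
        (by omega) (by omega)) x
      exact congrArg (map (ι B i) (map (ι B j) (ι B l))) this
  rTensor_counit_comp_comul := by
    refine hom_ext fun n => LinearMap.ext fun x => ?_
    simp only [LinearMap.comp_apply, comul_ι, map_sum]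
    rw [Finset.sum_eq_single (0, n)]
    · refine (rTensor_counit_ι_zero B n _).trans ?_
      have := LinearMap.congr_fun (B.part_counit_left n) x
      exact congrArg ((ι B n).lTensor k) this
    · rintro ⟨i, j⟩ h1 h2
      refine rTensor_counit_ι_of_ne B i j ?_ _
      rintro rfl
      simp at h1
      simp [h1] at h2
    · simp
  lTensor_counit_comp_comul := by
    refine hom_ext fun n => LinearMap.ext fun x => ?_
    simp only [LinearMap.comp_apply, comul_ι, map_sum]
    rw [Finset.sum_eq_single (n, 0)]
    · refine (lTensor_counit_ι_zero B n _).trans ?_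
      have := LinearMap.congr_fun (B.part_counit_right n) x
      exact congrArg ((ι B n).rTensor k) this
    · rintro ⟨i, j⟩ h1 h2
      refine lTensor_counit_ι_of_ne B i j ?_ _
      rintro rfl
      simp at h1
      simp [h1] at h2
    · simp

end CotensorCoalgebra
end Powers
end Comodules
section Duals

variable {k : Type u} [Field k] {A B E X Y Z : Type v} [AddCommGroup A] [Module k A]
  [AddCommGroup B] [Module k B] [AddCommGroup E] [Module k E] [AddCommGroup X] [Module k X]
  [AddCommGroup Y] [Module k Y] [AddCommGroup Z] [Module k Z]
  [FiniteDimensional k A] [FiniteDimensional k B]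

/-- The map `X^* → (A ⊗ B)^* ≅ A^* ⊗ B^*` dual to `μ : A ⊗ B → X`, for finite dimensional
`A` and `B`. -/
noncomputable def dualSplit (μ : A ⊗[k] B →ₗ[k] X) :
    Module.Dual k X →ₗ[k] Module.Dual k A ⊗[k] Module.Dual k B :=
  (TensorProduct.dualDistribEquiv k A B).symm.toLinearMap ∘ₗ μ.dualMap

theorem dualDistribEquiv_dualSplit (μ : A ⊗[k] B →ₗ[k] X) (f : Module.Dual k X) (t : A ⊗[k] B) :
    TensorProduct.dualDistribEquiv k A B (dualSplit μ f) t = f (μ t) := by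
  exact congrArg (fun g : Module.Dual k (A ⊗[k] B) => g t)
    ((TensorProduct.dualDistribEquiv k A B).apply_symm_apply (μ.dualMap f))

theorem dualDistribEquiv_tmul (f : Module.Dual k A) (g : Module.Dual k B) (a : A) (b : B) :
    TensorProduct.dualDistribEquiv k A B (f ⊗ₜ g) (a ⊗ₜ b) = f a * g b :=
  TensorProduct.dualDistrib_apply f g a b

theorem dualSplit_coassoc [FiniteDimensional k E] [FiniteDimensional k X] [FiniteDimensional k Z]
    (μ₁ : A ⊗[k] B →ₗ[k] X) (μ₂ : X ⊗[k] E →ₗ[k] Y)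
    (ν₁ : B ⊗[k] E →ₗ[k] Z) (ν₂ : A ⊗[k] Z →ₗ[k] Y)
    (h : ∀ a b e, μ₂ (μ₁ (a ⊗ₜ b) ⊗ₜ e) = ν₂ (a ⊗ₜ ν₁ (b ⊗ₜ e))) :
    (assoc k (Module.Dual k A) (Module.Dual k B) (Module.Dual k E)).toLinearMap ∘ₗ
        (dualSplit μ₁).rTensor (Module.Dual k E) ∘ₗ dualSplit μ₂ =
      (dualSplit ν₁).lTensor (Module.Dual k A) ∘ₗ dualSplit ν₂ := by
  refine LinearMap.ext fun f => ?_
  apply ((LinearEquiv.lTensor (Module.Dual k A) (TensorProduct.dualDistribEquiv k B E)).trans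
    (TensorProduct.dualDistribEquiv k A (B ⊗[k] E))).injective
  refine TensorProduct.ext_threefold' fun a b e => ?_
  have h1 : ∀ w : Module.Dual k X ⊗[k] Module.Dual k E,
      TensorProduct.dualDistribEquiv k A (B ⊗[k] E)
        ((TensorProduct.dualDistribEquiv k B E).toLinearMap.lTensor (Module.Dual k A)
          (assoc k _ _ _ ((dualSplit μ₁).rTensor (Module.Dual k E) w))) (a ⊗ₜ (b ⊗ₜ e)) =
      TensorProduct.dualDistribEquiv k X E w (μ₁ (a ⊗ₜ b) ⊗ₜ e) := by
    intro w
    induction w with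
    | zero => simp
    | add x y hx hy => simp only [map_add, LinearMap.add_apply, hx, hy]
    | tmul g l =>
      rw [LinearMap.rTensor_tmul, dualDistribEquiv_tmul, ← dualDistribEquiv_dualSplit]
      generalize dualSplit μ₁ g = z
      induction z with
      | zero => simp
      | add x y hx hy =>
        simp only [map_add, LinearMap.add_apply, TensorProduct.add_tmul, hx, hy, add_mul]
      | tmul p q =>
        simp only [TensorProduct.assoc_tmul, LinearMap.lTensor_tmul, dualDistribEquiv_tmul,
          LinearEquiv.coe_coe, mul_assoc]
  have h2 : ∀ w : Module.Dual k A ⊗[k] Module.Dual k Z,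
      TensorProduct.dualDistribEquiv k A (B ⊗[k] E)
        ((TensorProduct.dualDistribEquiv k B E).toLinearMap.lTensor (Module.Dual k A)
          ((dualSplit ν₁).lTensor (Module.Dual k A) w)) (a ⊗ₜ (b ⊗ₜ e)) =
      TensorProduct.dualDistribEquiv k A Z w (a ⊗ₜ ν₁ (b ⊗ₜ e)) := by
    intro w
    induction w with
    | zero => simp
    | add x y hx hy => simp only [map_add, LinearMap.add_apply, hx, hy]
    | tmul g l =>
      simp only [LinearMap.lTensor_tmul, dualDistribEquiv_tmul, LinearEquiv.coe_coe,
        dualDistribEquiv_dualSplit]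
  refine (h1 _).trans (Eq.trans ?_ (h2 _).symm)
  rw [dualDistribEquiv_dualSplit, dualDistribEquiv_dualSplit, h]

theorem dualSplit_counit_left (μ : A ⊗[k] B →ₗ[k] B) (e : A) (h : ∀ b, μ (e ⊗ₜ b) = b) :
    (Module.Dual.eval k A e).rTensor (Module.Dual k B) ∘ₗ dualSplit μ =
      TensorProduct.mk k k (Module.Dual k B) 1 := by
  refine LinearMap.ext fun f => ?_
  apply (TensorProduct.lid k (Module.Dual k B)).injective
  refine LinearMap.ext fun b => ?_
  have h1 : ∀ w : Module.Dual k A ⊗[k] Module.Dual k B,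
      TensorProduct.lid k (Module.Dual k B) ((Module.Dual.eval k A e).rTensor _ w) b =
      TensorProduct.dualDistribEquiv k A B w (e ⊗ₜ b) := by
    intro w
    induction w with
    | zero => simp
    | add x y hx hy => simp only [map_add, LinearMap.add_apply, hx, hy]
    | tmul g l => simp
  refine (h1 _).trans ?_
  rw [dualDistribEquiv_dualSplit, h]
  simp

theorem dualSplit_counit_right (μ : B ⊗[k] A →ₗ[k] B) (e : A) (h : ∀ b, μ (b ⊗ₜ e) = b) :
    (Module.Dual.eval k A e).lTensor (Module.Dual k B) ∘ₗ dualSplit μ =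
      (TensorProduct.mk k (Module.Dual k B) k).flip 1 := by
  refine LinearMap.ext fun f => ?_
  apply (TensorProduct.rid k (Module.Dual k B)).injective
  refine LinearMap.ext fun b => ?_
  have h1 : ∀ w : Module.Dual k B ⊗[k] Module.Dual k A,
      TensorProduct.rid k (Module.Dual k B) ((Module.Dual.eval k A e).lTensor _ w) b =
      TensorProduct.dualDistribEquiv k B A w (b ⊗ₜ e) := by
    intro w
    induction w with
    | zero => simp
    | add x y hx hy => simp only [map_add, LinearMap.add_apply, hx, hy]
    | tmul g l => simp [mul_comm]
  refine (h1 _).trans ?_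
  rw [dualDistribEquiv_dualSplit, h]
  simp

end Duals

section Actions

variable (k : Type u) [Field k] (D : Type v) [Ring D] [Algebra k D] (M : Type v) [AddCommGroup M]
  [Module k M]

/-- The left action `D ⊗ M → M`, `d ⊗ m ↦ d m`. -/
noncomputable def leftAction [Module D M] [IsScalarTower k D M] : D ⊗[k] M →ₗ[k] M :=
  TensorProduct.lift (Algebra.lsmul k k M : D →ₐ[k] Module.End k M).toLinearMap

/-- The right action `M ⊗ D → M`, `m ⊗ d ↦ m d`. -/
noncomputable def rightAction [Module Dᵐᵒᵖ M] [IsScalarTower k Dᵐᵒᵖ M] :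
    M ⊗[k] D →ₗ[k] M :=
  TensorProduct.lift ((Algebra.lsmul k k M : Dᵐᵒᵖ →ₐ[k] Module.End k M).toLinearMap ∘ₗ
    (MulOpposite.opLinearEquiv k).toLinearMap).flip

@[simp] theorem leftAction_tmul [Module D M] [IsScalarTower k D M] (d : D) (m : M) :
    leftAction k D M (d ⊗ₜ m) = d • m := by
  simp [leftAction]

@[simp] theorem rightAction_tmul [Module Dᵐᵒᵖ M] [IsScalarTower k Dᵐᵒᵖ M]
    (d : D) (m : M) :
    rightAction k D M (m ⊗ₜ d) = MulOpposite.op d • m := by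
  simp [rightAction]

end Actions

section DualCoalgebra

variable (k : Type u) [Field k] (D : Type v) [Ring D] [Algebra k D] [FiniteDimensional k D]

/-- The dual coalgebra `D^*` of a finite dimensional algebra `D`: the comultiplication is dual to
the multiplication, and the counit is evaluation at `1`. -/
noncomputable instance dualCoalgebra : Coalgebra k (Module.Dual k D) where
  comul := dualSplit (LinearMap.mul' k D)
  counit := Module.Dual.eval k D 1
  coassoc := dualSplit_coassoc _ _ _ _ (by simp [mul_assoc])
  rTensor_counit_comp_comul := dualSplit_counit_left _ _ (by simp)
  lTensor_counit_comp_comul := dualSplit_counit_right _ _ (by simp)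

variable (M : Type v) [AddCommGroup M] [Module k M] [Module D M] [Module Dᵐᵒᵖ M]
  [SMulCommClass D Dᵐᵒᵖ M] [IsScalarTower k D M] [IsScalarTower k Dᵐᵒᵖ M] [FiniteDimensional k M]

/-- The `D^*`-bicomodule `M^*` dual to a finite dimensional `D`-bimodule `M`. -/
noncomputable def dualBicomodule : Bicomodule k (Module.Dual k D) (Module.Dual k M) where
  left := dualSplit (leftAction k D M)
  right := dualSplit (rightAction k D M)
  left_coassoc := dualSplit_coassoc _ _ _ _ (by simp [mul_smul])
  left_counit := dualSplit_counit_left _ _ (by simp)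
  right_coassoc := dualSplit_coassoc _ _ _ _ (by simp [mul_smul])
  right_counit := dualSplit_counit_right _ _ (by simp)
  left_right := dualSplit_coassoc _ _ _ _ (by simp [smul_comm])

end DualCoalgebra

section DC

variable {k : Type u} [Field k] {D : Type v} [DivisionRing D] [Algebra k D]

/-- The `D`-bimodule `D_α`: the vector space `D` with `a ▷ x = a x` and `x ◁ b = x α(b)`. -/
def TwistedBimodule (_α : D ≃ₐ[k] D) : Type v := D

variable (α : D ≃ₐ[k] D)

namespace TwistedBimodule

instance : AddCommGroup (TwistedBimodule α) := inferInstanceAs (AddCommGroup D)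

instance : Module k (TwistedBimodule α) := inferInstanceAs (Module k D)

instance : Module D (TwistedBimodule α) := inferInstanceAs (Module D D)

/-- The element of `D_α` given by an element of `D`. -/
def of (x : D) : TwistedBimodule α := x

noncomputable instance : Module Dᵐᵒᵖ (TwistedBimodule α) :=
  Module.compHom D (RingEquiv.op (α : D ≃+* D)).toRingHom

theorem smul_of (a x : D) : a • of α x = of α (a * x) := rfl

theorem op_smul_of (b x : D) : MulOpposite.op b • of α x = of α (x * α b) := rfl

instance : SMulCommClass D Dᵐᵒᵖ (TwistedBimodule α) where
  smul_comm a b x := (mul_assoc a (show D from x) (α b.unop)).symm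

instance : IsScalarTower k D (TwistedBimodule α) := inferInstanceAs (IsScalarTower k D D)

instance : IsScalarTower k Dᵐᵒᵖ (TwistedBimodule α) where
  smul_assoc c b x := by
    have h : (show D from x) * α (c • b.unop) = c • ((show D from x) * α b.unop) := by
      rw [map_smul, mul_smul_comm]
    exact h

instance [FiniteDimensional k D] : FiniteDimensional k (TwistedBimodule α) :=
  inferInstanceAs (FiniteDimensional k D)

end TwistedBimodule

/-- `DC(D, α) = T_{D^*}(D_α^*)`. -/
abbrev DC [FiniteDimensional k D] : Type (max u v) :=
  CotensorCoalgebra (dualBicomodule k D (TwistedBimodule α))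

end DC

end ChainCoalgebra

/-!
Right coideals of `C` are the subspaces stable under the left action of the convolution algebra
`C^*`, so kernels and images of the right action `c ↦ c · a` are right coideals. When these form a
chain and `C` is infinite-dimensional, `C^*` behaves like a noncommutative discrete valuation ring:
it is a complete local domain with finite-dimensional residue division algebra `D`, and its maximal
ideal is generated by a single element `x`. As `k` is perfect, `D` is separable, so `C^* → D` has an
algebra section `s`; separability also allows `x` to be multiplied by a unit so that
`x s(d) = s(α d) x` for an automorphism `α` of `D`. Dualizing `s` and `d ↦ s(d) x` gives maps
`C → D^*` and `C → D_α^*`, hence a coalgebra map from `C` to the cotensor coalgebra. It is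
bijective: contracting all tensor factors with `1` embeds `(D_α^*)^{□ n}` in `D^*` and turns the
`n`-th component of the map into `c ↦ s^*(c · x^n)`, while `x` acts surjectively and locally
nilpotently on `C`, with kernel mapped isomorphically onto `D^*` by `s^*`.
-/

namespace ChainCoalgebra

open scoped TensorProduct

section Separability

theorem exists_trace_restrictScalars_ne_zero (k L V : Type*) [Field k] [Field L] [Algebra k L]
    [FiniteDimensional k L] [Algebra.IsSeparable k L] [AddCommGroup V] [Nontrivial V] [Module k V]
    [Module L V] [IsScalarTower k L V] [FiniteDimensional k V] :
    ∃ g : V →ₗ[L] V, LinearMap.trace k V (g.restrictScalars k) ≠ 0 := by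
  obtain ⟨v, hv⟩ := exists_ne (0 : V)
  obtain ⟨φ, hφ⟩ := LinearMap.exists_leftInverse_of_injective (LinearMap.toSpanSingleton L V v)
    (LinearMap.ker_toSpanSingleton L hv)
  obtain ⟨z, hz⟩ : ∃ z, Algebra.trace k L z ≠ 0 :=
    not_forall.1 fun h => Algebra.trace_ne_zero k L (LinearMap.ext h)
  let incl : L →ₗ[k] V := (LinearMap.toSpanSingleton L V v).restrictScalars k
  let proj : V →ₗ[k] L := φ.restrictScalars k
  have proj_incl : proj ∘ₗ incl = LinearMap.id :=
    LinearMap.ext fun w => LinearMap.congr_fun hφ w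
  refine ⟨LinearMap.toSpanSingleton L V v ∘ₗ LinearMap.mulLeft L z ∘ₗ φ, ?_⟩
  change LinearMap.trace k V (incl ∘ₗ LinearMap.mulLeft k z ∘ₗ proj) ≠ 0
  rwa [LinearMap.trace_comp_comm', LinearMap.comp_assoc, proj_incl, LinearMap.comp_id]

/-- The family `e i ⊗ f i` sums to a separability idempotent of the `k`-algebra `A`: an element of
`A ⊗ A` that multiplies to `1` and on which the two outer actions of `A` agree. -/
structure IsSeparabilityIdempotent (k : Type*) {A ι : Type*} [Field k] [Ring A] [Algebra k A]
    [Fintype ι] (e f : ι → A) : Prop where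
  sum_mul : ∑ i, e i * f i = 1
  sum_tmul_comm : ∀ d, ∑ i, (d * e i) ⊗ₜ[k] f i = ∑ i, e i ⊗ₜ[k] (f i * d)

variable {k A ι V : Type*} [Field k] [Ring A] [Algebra k A] [Fintype ι]
  [AddCommGroup V] [Module k V]

theorem sum_bilin_comm {e f : ι → A}
    (h : ∀ d, ∑ i, (d * e i) ⊗ₜ[k] f i = ∑ i, e i ⊗ₜ[k] (f i * d))
    (B : A →ₗ[k] A →ₗ[k] V) (d : A) : ∑ i, B (d * e i) (f i) = ∑ i, B (e i) (f i * d) := by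
  simpa using congrArg (TensorProduct.lift B) (h d)

section DualFamilies

variable {t : A →ₗ[k] k} {e f : ι → A}

theorem sum_mul_tmul_eq_sum_tmul_mul (he : ∀ y, ∑ i, t (f i * y) • e i = y)
    (hf : ∀ y, ∑ i, t (y * e i) • f i = y) (d : A) :
    ∑ i, (d * e i) ⊗ₜ[k] f i = ∑ i, e i ⊗ₜ[k] (f i * d) :=
  calc ∑ i, (d * e i) ⊗ₜ[k] f i
      = ∑ i, ∑ j, t (f j * d * e i) • e j ⊗ₜ[k] f i := by
        refine Finset.sum_congr rfl fun i _ => ?_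
        rw [← he (d * e i), TensorProduct.sum_tmul]
        simp only [mul_assoc, TensorProduct.smul_tmul']
    _ = ∑ j, ∑ i, t (f j * d * e i) • e j ⊗ₜ[k] f i := Finset.sum_comm
    _ = ∑ j, e j ⊗ₜ[k] (f j * d) := by
        refine Finset.sum_congr rfl fun j _ => ?_
        rw [← hf (f j * d), TensorProduct.tmul_sum]
        simp only [hf, TensorProduct.tmul_smul]

theorem trace_eq_sum [FiniteDimensional k A] (he : ∀ y, ∑ i, t (f i * y) • e i = y)
    (g : A →ₗ[k] A) : LinearMap.trace k A g = ∑ i, t (f i * g (e i)) := by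
  have hg : g = ∑ i, dualTensorHom k A A ((t ∘ₗ LinearMap.mulLeft k (f i)) ⊗ₜ g (e i)) :=
    LinearMap.ext fun y => by
      conv_lhs => rw [← he y]
      simp
  conv_lhs => rw [hg]
  simp [LinearMap.trace_eq_contract_apply]

end DualFamilies

theorem exists_dual_families [FiniteDimensional k A] {t : A →ₗ[k] k}
    (ht : ((LinearMap.mul k A).compr₂ t).Nondegenerate) :
    ∃ (n : ℕ) (e f : Fin n → A), (∀ y, ∑ i, t (f i * y) • e i = y) ∧
      ∀ y, ∑ i, t (y * e i) • f i = y := by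
  let e := Module.finBasis k A
  let f := LinearMap.BilinForm.dualBasis ((LinearMap.mul k A).compr₂ t) ht e
  have hfe : ∀ i j, t (f i * e j) = if j = i then 1 else 0 :=
    LinearMap.BilinForm.apply_dualBasis_left ht e
  refine ⟨_, e, f, fun y => ?_, fun y => ?_⟩
  · have repr_e (i) : t (f i * y) = e.repr y i := by
      conv_lhs => rw [← e.sum_repr y]
      simp [Finset.mul_sum, hfe, -Module.Basis.sum_repr]
    simp only [repr_e, e.sum_repr]
  · have repr_f (i) : t (y * e i) = f.repr y i := by
      conv_lhs => rw [← f.sum_repr y]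
      simp [Finset.sum_mul, hfe, -Module.Basis.sum_repr]
    simp only [repr_f, f.sum_repr]

section Simple

variable [IsSimpleRing A]

theorem exists_mulLeftRight_apply_eq {a : A} (ha : a ≠ 0) (b : A) :
    ∃ w, AlgHom.mulLeftRight k A w a = b := by
  let I : TwoSidedIdeal A := .mk' {c | ∃ w, AlgHom.mulLeftRight k A w a = c} ⟨0, by simp⟩
    (fun ⟨w, hw⟩ ⟨w', hw'⟩ => ⟨w + w', by simp [hw, hw']⟩)
    (fun ⟨w, hw⟩ => ⟨-w, by simp [hw]⟩)
    (fun {x _} ⟨w, hw⟩ => ⟨x ⊗ₜ 1 * w, by simp [hw]⟩)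
    (fun {_ y} ⟨w, hw⟩ => ⟨1 ⊗ₜ MulOpposite.op y * w, by simp [hw]⟩)
  have hmem : ∀ c, c ∈ I ↔ ∃ w, AlgHom.mulLeftRight k A w a = c := fun c => by
    simp only [I, TwoSidedIdeal.mem_mk', Set.mem_ofPred_eq]
  have hI : I ≠ ⊥ := fun h => ha <| by
    simpa [h, TwoSidedIdeal.mem_bot] using (hmem a).2 ⟨1, by simp⟩
  have htop : I = ⊤ := (eq_bot_or_eq_top I).resolve_left hI
  exact (hmem b).1 (htop ▸ trivial)

theorem exists_mulLeftRight_eq [FiniteDimensional k A] (g : A →ₗ[k] A)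
    (hg : ∀ z ∈ Subalgebra.center k A, ∀ y, g (z * y) = z * g y) :
    ∃ w, AlgHom.mulLeftRight k A w = g := by
  let : Module (A ⊗[k] Aᵐᵒᵖ) A := Module.compHom A (AlgHom.mulLeftRight k A).toRingHom
  have smul_def (w : A ⊗[k] Aᵐᵒᵖ) (y : A) : w • y = AlgHom.mulLeftRight k A w y := rfl
  have : IsSimpleModule (A ⊗[k] Aᵐᵒᵖ) A :=
    isSimpleModule_iff_toSpanSingleton_surjective.2
      ⟨inferInstance, fun _ ha b => exists_mulLeftRight_apply_eq ha b⟩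
  have eq_mul (φ : Module.End (A ⊗[k] Aᵐᵒᵖ) A) (y : A) : φ y = φ 1 * y := by
    simpa [smul_def] using φ.map_smul (1 ⊗ₜ MulOpposite.op y) 1
  have mem_center (φ : Module.End (A ⊗[k] Aᵐᵒᵖ) A) : φ 1 ∈ Subalgebra.center k A :=
    Subalgebra.mem_center_iff.2 fun y => by
      rw [← eq_mul]
      simpa [smul_def] using (φ.map_smul (y ⊗ₜ 1) 1).symm
  let G : Module.End (Module.End (A ⊗[k] Aᵐᵒᵖ) A) A :=
    { toFun := g
      map_add' := g.map_add
      map_smul' := fun φ y => by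
        simp only [Module.End.smul_def, RingHom.id_apply]
        rw [eq_mul φ y, hg _ (mem_center φ), ← eq_mul φ] }
  classical
  let b := Module.finBasis k A
  obtain ⟨w, hw⟩ := jacobson_density G (Finset.univ.image b)
  exact ⟨w, b.ext fun i => (hw (b i) (by simp)).symm⟩

variable (k A) in
theorem isField_center : IsField (Subalgebra.center k A) :=
  IsSimpleRing.isField_center A

theorem exists_center_linear_trace_ne_zero [FiniteDimensional k A]
    [Algebra.IsSeparable k (Subalgebra.center k A)] :
    ∃ g : A →ₗ[k] A, (∀ z ∈ Subalgebra.center k A, ∀ y, g (z * y) = z * g y) ∧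
      LinearMap.trace k A g ≠ 0 := by
  let : Field (Subalgebra.center k A) := (isField_center k A).toField
  obtain ⟨g, hg⟩ := exists_trace_restrictScalars_ne_zero k (Subalgebra.center k A) A
  exact ⟨g.restrictScalars k, fun z hz => g.map_smul ⟨z, hz⟩, hg⟩

/-- The linear form `a ↦ tr (y ↦ a * y * u)`. For `u = 1` this is the trace form of the regular
representation, which vanishes identically when the characteristic divides the degree of `A`. -/
noncomputable def twistedTrace (k : Type*) {A : Type*} [Field k] [Ring A] [Algebra k A] (u : A) :
    A →ₗ[k] k :=
  LinearMap.trace k A ∘ₗ LinearMap.lcomp k A (LinearMap.mulRight k u) ∘ₗ LinearMap.mul k A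

theorem twistedTrace_apply {A : Type*} [Ring A] [Algebra k A] (u a : A) :
    twistedTrace k u a =
      LinearMap.trace k A (LinearMap.mulLeft k a ∘ₗ LinearMap.mulRight k u) := rfl

theorem twistedTrace_mul_comm {A : Type*} [Ring A] [Algebra k A] (u a b : A) :
    twistedTrace k u (a * b) = twistedTrace k u (b * a) := by
  have hab : LinearMap.mulLeft k (a * b) ∘ₗ LinearMap.mulRight k u =
      LinearMap.mulLeft k a * (LinearMap.mulLeft k b ∘ₗ LinearMap.mulRight k u) := by
    ext y; simp
  have hba : LinearMap.mulLeft k (b * a) ∘ₗ LinearMap.mulRight k u =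
      (LinearMap.mulLeft k b ∘ₗ LinearMap.mulRight k u) * LinearMap.mulLeft k a := by
    ext y; simp [mul_assoc]
  rw [twistedTrace_apply, twistedTrace_apply, hab, hba, LinearMap.trace_mul_comm]

theorem exists_twistedTrace_ne_zero [FiniteDimensional k A]
    [Algebra.IsSeparable k (Subalgebra.center k A)] : ∃ u v : A, twistedTrace k u v ≠ 0 := by
  by_contra! h
  obtain ⟨g, hg, hne⟩ := exists_center_linear_trace_ne_zero (k := k) (A := A)
  obtain ⟨w, rfl⟩ := exists_mulLeftRight_eq g hg
  apply hne
  clear hne hg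
  induction w with
  | zero => simp
  | add w w' hw hw' => simp [hw, hw']
  | tmul a b =>
    rw [← h b.unop a, twistedTrace_apply]
    exact congrArg _ (LinearMap.ext fun y => by simp [mul_assoc])

theorem nondegenerate_mul_compr₂ {t : A →ₗ[k] k}
    (hcomm : ∀ a b, t (a * b) = t (b * a)) (ht : t ≠ 0) :
    ((LinearMap.mul k A).compr₂ t).Nondegenerate := by
  have hsymm : LinearMap.BilinForm.IsSymm ((LinearMap.mul k A).compr₂ t) := ⟨hcomm⟩
  refine hsymm.isRefl.nondegenerate_iff_separatingLeft.2 fun a ha => ?_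
  by_contra hne
  refine ht (LinearMap.ext fun v => ?_)
  obtain ⟨w, rfl⟩ := exists_mulLeftRight_apply_eq (k := k) hne v
  induction w with
  | zero => simp
  | add w w' hw hw' => simp_all
  | tmul b c =>
    have hac : t (a * (c.unop * b)) = 0 := ha _
    rw [← mul_assoc, hcomm, ← mul_assoc] at hac
    simpa using hac

variable (k A) in
theorem exists_isSeparabilityIdempotent [FiniteDimensional k A]
    [Algebra.IsSeparable k (Subalgebra.center k A)] :
    ∃ (n : ℕ) (e f : Fin n → A), IsSeparabilityIdempotent k e f := by
  obtain ⟨u, v, huv⟩ := exists_twistedTrace_ne_zero (k := k) (A := A)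
  obtain ⟨n, e, f, he, hf⟩ := exists_dual_families <|
    nondegenerate_mul_compr₂ (twistedTrace_mul_comm u) (fun h => huv (LinearMap.congr_fun h v))
  have casimir := sum_mul_tmul_eq_sum_tmul_mul he hf
  have hγ : ∑ i, e i * u * f i ∈ Subalgebra.center k A :=
    Subalgebra.mem_center_iff.2 fun d => by
      simpa [Finset.mul_sum, Finset.sum_mul, mul_assoc] using
        sum_bilin_comm casimir (LinearMap.mul k A ∘ₗ LinearMap.mulRight k u) d
  have hγ0 : (⟨_, hγ⟩ : Subalgebra.center k A) ≠ 0 := fun h0 => huv <| by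
    rw [twistedTrace_apply, trace_eq_sum he]
    calc ∑ i, twistedTrace k u (f i * (v * (e i * u)))
        = ∑ i, twistedTrace k u (v * (e i * u * f i)) :=
          Finset.sum_congr rfl fun i _ => by rw [twistedTrace_mul_comm]; simp only [mul_assoc]
      _ = twistedTrace k u (v * ∑ i, e i * u * f i) := by rw [Finset.mul_sum, map_sum]
      _ = 0 := by rw [show ∑ i, e i * u * f i = 0 from congrArg Subtype.val h0]; simp
  obtain ⟨⟨c, hc⟩, hγc⟩ := (isField_center k A).mul_inv_cancel hγ0
  have hcomm : ∀ y, y * c = c * y := Subalgebra.mem_center_iff.1 hc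
  refine ⟨n, fun i => e i * (u * c), f, ?_, fun d => ?_⟩
  · calc ∑ i, e i * (u * c) * f i = (∑ i, e i * u * f i) * c := by
          rw [Finset.sum_mul]
          exact Finset.sum_congr rfl fun i _ => by simp only [mul_assoc, hcomm (f i)]
      _ = 1 := congrArg Subtype.val hγc
  · simpa [mul_assoc] using congrArg ((LinearMap.mulRight k (u * c)).rTensor A) (casimir d)

end Simple

variable (k A) in
theorem exists_isSeparabilityIdempotent_of_perfectField [PerfectField k] [IsSimpleRing A]
    [FiniteDimensional k A] : ∃ (n : ℕ) (e f : Fin n → A), IsSeparabilityIdempotent k e f := by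
  let : Field (Subalgebra.center k A) := (isField_center k A).toField
  have : Algebra.IsSeparable k (Subalgebra.center k A) :=
    Algebra.IsAlgebraic.isSeparable_of_perfectField
  exact exists_isSeparabilityIdempotent k A

end Separability

section Lifting

/-- Every sequence that is Cauchy for the powers of the two-sided ideal `I` has a unique limit.
(The `IsAdicComplete` of Mathlib is reserved for commutative rings.) -/
structure IsAdicallyComplete {A : Type*} [Ring A] (I : Ideal A) [I.IsTwoSided] : Prop where
  separated : ∀ a, (∀ n, a ∈ I ^ n) → a = 0
  complete : ∀ a : ℕ → A, (∀ n, a (n + 1) - a n ∈ I ^ n) → ∃ c, ∀ n, c - a n ∈ I ^ n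

variable {k A D V ι : Type*} [Field k] [Ring A] [Algebra k A] [Ring D] [Algebra k D]
  [AddCommGroup V] [Module k V] [Fintype ι]

theorem IsAdicallyComplete.eq_one_of_isIdempotentElem {I : Ideal A} [I.IsTwoSided]
    (hI : IsAdicallyComplete I) {a : A} (ha : IsIdempotentElem a) (h : 1 - a ∈ I) : a = 1 := by
  refine (sub_eq_zero.1 <| hI.separated _ fun n => ?_).symm
  rw [← ha.one_sub.pow_succ_eq n]
  exact Ideal.pow_le_pow_right n.le_succ (Ideal.pow_mem_pow h _)

theorem IsAdicallyComplete.exists_linearMap_limit {I : Ideal A} [I.IsTwoSided]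
    (hI : IsAdicallyComplete I) (S : ℕ → V →ₗ[k] A)
    (hS : ∀ n v, S (n + 1) v - S n v ∈ I ^ n) :
    ∃ s : V →ₗ[k] A, ∀ n v, s v - S n v ∈ I ^ n := by
  choose c hc using fun v => hI.complete (S · v) (hS · v)
  refine ⟨{ toFun := c, map_add' := fun v w => ?_, map_smul' := fun r v => ?_ }, fun n v => hc v n⟩
  · refine sub_eq_zero.1 <| hI.separated _ fun n => ?_
    have := sub_mem (hc (v + w) n) (add_mem (hc v n) (hc w n))
    rw [map_add] at this
    convert this using 1
    abel
  · refine sub_eq_zero.1 <| hI.separated _ fun n => ?_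
    have := sub_mem (hc (r • v) n) (Submodule.smul_of_tower_mem (I ^ n) r (hc v n))
    rw [map_smul, smul_sub] at this
    simpa using this

/-- The Hochschild 2-cocycle measuring how far the linear map `s` is from being multiplicative. -/
def mulDefect (s : D →ₗ[k] A) : D →ₗ[k] D →ₗ[k] A :=
  (LinearMap.mul k A).compl₁₂ s s - (LinearMap.mul k D).compr₂ s

theorem mulDefect_apply (s : D →ₗ[k] A) (a b : D) : mulDefect s a b = s a * s b - s (a * b) := rfl

theorem mulDefect_sub (s g : D →ₗ[k] A) (a b : D) :
    mulDefect (s - g) a b =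
      mulDefect s a b - (s a * g b - g (a * b) + g a * s b) + g a * g b := by
  simp only [mulDefect_apply, LinearMap.sub_apply]
  noncomm_ring

/-- The contraction of `mulDefect s` with `∑ e i ⊗ f i`. When the latter is a separability
idempotent and `s` is multiplicative to first order, this is a cochain bounding `mulDefect s`. -/
def contractMulDefect (s : D →ₗ[k] A) (e f : ι → D) : D →ₗ[k] A :=
  ∑ i, LinearMap.mulLeft k (s (e i)) ∘ₗ mulDefect s (f i)

theorem contractMulDefect_apply (s : D →ₗ[k] A) (e f : ι → D) (a : D) :
    contractMulDefect s e f a = ∑ i, s (e i) * mulDefect s (f i) a := by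
  simp [contractMulDefect]

theorem mulDefect_sub_coboundary {e f : ι → D}
    (hef : ∀ d, ∑ i, (d * e i) ⊗ₜ[k] f i = ∑ i, e i ⊗ₜ[k] (f i * d)) (s : D →ₗ[k] A) (a b : D) :
    mulDefect s a b - (s a * contractMulDefect s e f b - contractMulDefect s e f (a * b) +
        contractMulDefect s e f a * s b) =
      (1 - ∑ i, s (e i) * s (f i)) * mulDefect s a b -
        ∑ i, mulDefect s a (e i) * mulDefect s (f i) b := by
  have left_mul : s a * contractMulDefect s e f b =
      ∑ i, mulDefect s a (e i) * mulDefect s (f i) b + ∑ i, s (a * e i) * mulDefect s (f i) b := by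
    rw [contractMulDefect_apply, Finset.mul_sum, ← Finset.sum_add_distrib]
    refine Finset.sum_congr rfl fun i _ => ?_
    rw [mulDefect_apply s a]
    noncomm_ring
  have comm : ∑ i, s (a * e i) * mulDefect s (f i) b = ∑ i, s (e i) * mulDefect s (f i * a) b :=
    sum_bilin_comm hef ((LinearMap.mul k A).compl₁₂ s ((mulDefect s).flip b)) a
  have cocycle (i) : s (e i) * mulDefect s (f i * a) b = s (e i) * s (f i) * mulDefect s a b +
      s (e i) * mulDefect s (f i) (a * b) - s (e i) * mulDefect s (f i) a * s b := by
    simp only [mulDefect_apply, mul_assoc (f i)]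
    noncomm_ring
  rw [left_mul, comm, Finset.sum_congr rfl fun i _ => cocycle i, Finset.sum_sub_distrib,
    Finset.sum_add_distrib, ← Finset.sum_mul, ← Finset.sum_mul, ← contractMulDefect_apply,
    ← contractMulDefect_apply, sub_mul, one_mul]
  abel

section Section

variable {q : A →ₐ[k] D}

theorem exists_linear_section_step {e f : ι → D} (hef : IsSeparabilityIdempotent k e f) {n : ℕ}
    {s : D →ₗ[k] A} (hq : ∀ d, q (s d) = d)
    (hs : ∀ a b, mulDefect s a b ∈ RingHom.ker q ^ (n + 1)) :
    ∃ s' : D →ₗ[k] A, (∀ d, q (s' d) = d) ∧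
      (∀ a b, mulDefect s' a b ∈ RingHom.ker q ^ (n + 2)) ∧
      ∀ d, s' d - s d ∈ RingHom.ker q ^ (n + 1) := by
  set I := RingHom.ker q
  let g := contractMulDefect s e f
  have g_mem (a) : g a ∈ I ^ (n + 1) := by
    rw [contractMulDefect_apply]
    exact sum_mem fun i _ => Ideal.mul_mem_left _ _ (hs _ _)
  have mul_mem {a b : A} (ha : a ∈ I) (hb : b ∈ I ^ (n + 1)) : a * b ∈ I ^ (n + 2) := by
    rw [Ideal.IsTwoSided.pow_succ]
    exact Ideal.mul_mem_mul ha hb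
  have mem_I {a : A} (ha : a ∈ I ^ (n + 1)) : a ∈ I := Ideal.pow_le_self n.succ_ne_zero ha
  have one_sub_mem : 1 - ∑ i, s (e i) * s (f i) ∈ I := by
    simp [I, RingHom.mem_ker, hq, hef.sum_mul]
  refine ⟨s - g, fun d => ?_, fun a b => ?_, fun d => ?_⟩
  · rw [LinearMap.sub_apply, map_sub, hq, (RingHom.mem_ker (f := q)).1 (mem_I (g_mem d)), sub_zero]
  · rw [mulDefect_sub, mulDefect_sub_coboundary hef.sum_tmul_comm]
    exact add_mem (sub_mem (mul_mem one_sub_mem (hs a b))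
      (sum_mem fun i _ => mul_mem (mem_I (hs _ _)) (hs _ _))) (mul_mem (mem_I (g_mem a)) (g_mem b))
  · simpa using g_mem d

theorem exists_approximate_sections {e f : ι → D} (hef : IsSeparabilityIdempotent k e f)
    (hq : Function.Surjective q) :
    ∃ S : ℕ → D →ₗ[k] A, (∀ n d, q (S n d) = d) ∧
      (∀ n a b, mulDefect (S n) a b ∈ RingHom.ker q ^ (n + 1)) ∧
      ∀ n d, S (n + 1) d - S n d ∈ RingHom.ker q ^ (n + 1) := by
  obtain ⟨s₀, hs₀⟩ := LinearMap.exists_rightInverse_of_surjective q.toLinearMap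
    (LinearMap.range_eq_top.2 hq)
  have hs₀ (d) : q (s₀ d) = d := LinearMap.congr_fun hs₀ d
  choose! next hnext using fun (s : D →ₗ[k] A) (n : ℕ) (hs : (∀ d, q (s d) = d) ∧
    ∀ a b, mulDefect s a b ∈ RingHom.ker q ^ (n + 1)) => exists_linear_section_step hef hs.1 hs.2
  let S : ℕ → D →ₗ[k] A := fun n => Nat.rec s₀ (fun n s => next s n) n
  have hS (n) : (∀ d, q (S n d) = d) ∧
      ∀ a b, mulDefect (S n) a b ∈ RingHom.ker q ^ (n + 1) := by
    induction n with
    | zero => exact ⟨hs₀, fun a b => by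
      simp [S, mulDefect_apply, Submodule.pow_one, RingHom.mem_ker, hs₀]⟩
    | succ n ih => exact ⟨(hnext _ n ih).1, (hnext _ n ih).2.1⟩
  exact ⟨S, fun n => (hS n).1, fun n => (hS n).2, fun n => (hnext _ n (hS n)).2.2⟩

theorem exists_algHom_section {e f : ι → D} (hef : IsSeparabilityIdempotent k e f)
    (hq : Function.Surjective q) (hI : IsAdicallyComplete (RingHom.ker q)) :
    ∃ s : D →ₐ[k] A, ∀ d, q (s d) = d := by
  obtain ⟨S, hqS, hmulS, hS⟩ := exists_approximate_sections hef hq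
  obtain ⟨s, hs⟩ := hI.exists_linearMap_limit S
    fun n d => Ideal.pow_le_pow_right n.le_succ (hS n d)
  have hqs (d) : q (s d) = d := by
    have : q (s d - S 1 d) = 0 := by
      simpa only [Submodule.pow_one, RingHom.mem_ker] using hs 1 d
    rwa [map_sub, hqS, sub_eq_zero] at this
  have hmul (a b) : s (a * b) = s a * s b := by
    refine (sub_eq_zero.1 <| hI.separated _ fun n => ?_).symm
    have decompose : s a * s b - s (a * b) = (s a - S n a) * s b + S n a * (s b - S n b) +
        mulDefect (S n) a b - (s (a * b) - S n (a * b)) := by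
      rw [mulDefect_apply]
      noncomm_ring
    rw [decompose]
    exact sub_mem (add_mem (add_mem (Ideal.mul_mem_right _ _ (hs n a))
      (Ideal.mul_mem_left _ _ (hs n b))) (Ideal.pow_le_pow_right n.le_succ (hmulS n a b))) (hs n _)
  have hone : s 1 = 1 := hI.eq_one_of_isIdempotentElem
    (by rw [IsIdempotentElem, ← hmul, one_mul]) (by simp [RingHom.mem_ker, hqs])
  exact ⟨AlgHom.ofLinearMap s hone hmul, hqs⟩

end Section

/-- The element `x` is left cancellable and generates the kernel of `q` as a right ideal. -/
structure IsUniformizer (q : A →ₐ[k] D) (x : A) : Prop where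
  isLeftRegular : IsLeftRegular x
  map_eq_zero_iff : ∀ a, q a = 0 ↔ x ∣ a

namespace IsUniformizer

variable {q : A →ₐ[k] D} {x : A}

theorem mul_isUnit (hx : IsUniformizer q x) {u : A} (hu : IsUnit u) : IsUniformizer q (x * u) where
  isLeftRegular := hx.isLeftRegular.mul hu.isRegular.left
  map_eq_zero_iff a := by
    obtain ⟨u, rfl⟩ := hu
    rw [hx.map_eq_zero_iff]
    refine ⟨?_, (dvd_of_mul_right_dvd ·)⟩
    rintro ⟨b, rfl⟩
    exact ⟨↑u⁻¹ * b, by simp [mul_assoc]⟩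

theorem dvd_mul_self (hx : IsUniformizer q x) (a : A) : x ∣ a * x := by
  rw [← hx.map_eq_zero_iff, map_mul, (hx.map_eq_zero_iff x).2 dvd_rfl, mul_zero]

theorem mem_ker_pow_iff (hx : IsUniformizer q x) {n : ℕ} {a : A} :
    a ∈ RingHom.ker q ^ n ↔ x ^ n ∣ a := by
  refine ⟨fun ha => ?_, ?_⟩
  · induction n generalizing a with
    | zero => simp
    | succ n ih =>
      rw [Submodule.pow_succ] at ha
      induction ha using Submodule.smul_induction_on' with
      | smul b hb c hc =>
        obtain ⟨b, rfl⟩ := ih hb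
        obtain ⟨c, rfl⟩ := (hx.map_eq_zero_iff c).1 hc
        obtain ⟨b', hb'⟩ := hx.dvd_mul_self b
        refine ⟨b' * c, ?_⟩
        calc x ^ n * b * (x * c) = x ^ n * (b * x) * c := by simp only [mul_assoc]
          _ = x ^ (n + 1) * (b' * c) := by simp only [hb', pow_succ, mul_assoc]
      | add _ _ _ _ hb hc => exact dvd_add hb hc
  · rintro ⟨b, rfl⟩
    exact Ideal.mul_mem_right _ _ (Ideal.pow_mem_pow ((hx.map_eq_zero_iff x).2 dvd_rfl) n)

end IsUniformizer

theorem exists_algHom_mul_eq {x : A} (hx : IsLeftRegular x) (h : ∀ a, x ∣ a * x) :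
    ∃ σ : A →ₐ[k] A, ∀ a, a * x = x * σ a := by
  choose σ hσ using h
  refine ⟨AlgHom.ofLinearMap
    { toFun := σ, map_add' := fun a b => hx ?_, map_smul' := fun c a => hx ?_ }
    (hx ?_) fun a b => hx ?_, hσ⟩
  · simp only [mul_add, ← hσ, add_mul]
  · simp only [RingHom.id_apply, mul_smul_comm, ← hσ, smul_mul_assoc]
  · change x * σ 1 = x * 1
    rw [← hσ, one_mul, mul_one]
  · change x * σ (a * b) = x * (σ a * σ b)
    rw [← hσ, ← mul_assoc, ← hσ, mul_assoc, hσ b, ← mul_assoc, hσ a, mul_assoc]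

theorem IsUniformizer.exists_twist [IsSimpleRing D] [FiniteDimensional k D] {q : A →ₐ[k] D} {x : A}
    (hx : IsUniformizer q x) {e f : ι → D} (hef : IsSeparabilityIdempotent k e f) {s : D →ₐ[k] A}
    (hs : ∀ d, q (s d) = d) :
    ∃ (α : D ≃ₐ[k] D) (u : A), q u = 1 ∧ ∀ d, x * u * s d = s (α d) * (x * u) := by
  obtain ⟨σ, hσ⟩ := exists_algHom_mul_eq (k := k) hx.isLeftRegular hx.dvd_mul_self
  let τ : D →ₐ[k] D := (q.comp σ).comp s
  have hτ : Function.Bijective τ := by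
    have inj : Function.Injective τ := τ.toRingHom.injective
    exact ⟨inj, LinearMap.injective_iff_surjective (f := τ.toLinearMap).1 inj⟩
  let α := (AlgEquiv.ofBijective τ hτ).symm
  have hα (d) : τ (α d) = d := (AlgEquiv.ofBijective τ hτ).apply_symm_apply d
  let u := ∑ i, σ (s (e i)) * s (τ (f i))
  have hxu : x * u = ∑ i, s (e i) * x * s (τ (f i)) := by
    simp only [u, Finset.mul_sum, hσ, mul_assoc]
  refine ⟨α, u, ?_, fun d => ?_⟩
  · calc q u = ∑ i, τ (e i) * τ (f i) := by simp [u, hs, τ]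
      _ = τ (∑ i, e i * f i) := by simp only [map_sum, map_mul]
      _ = 1 := by rw [hef.sum_mul, map_one]
  · calc x * u * s d = ∑ i, s (e i) * x * s (τ (f i * α d)) := by
          simp only [hxu, Finset.sum_mul, map_mul, hα, mul_assoc]
      _ = ∑ i, s (α d * e i) * x * s (τ (f i)) :=
          (sum_bilin_comm hef.sum_tmul_comm ((LinearMap.mul k A).compl₁₂
            (LinearMap.mulRight k x ∘ₗ s.toLinearMap) (s.toLinearMap ∘ₗ τ.toLinearMap)) (α d)).symm
      _ = s (α d) * (x * u) := by simp only [hxu, Finset.mul_sum, map_mul, mul_assoc]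

end Lifting

section ConvDual

variable {k : Type*} [Field k]

theorem eq_zero_of_forall_lTensor_eq_zero {V W : Type*} [AddCommGroup V] [Module k V]
    [AddCommGroup W] [Module k W] {w : V ⊗[k] W}
    (h : ∀ f : W →ₗ[k] k, TensorProduct.rid k V (f.lTensor V w) = 0) : w = 0 := by
  classical
  let b := Module.Basis.ofVectorSpace k W
  refine (TensorProduct.equivFinsuppOfBasisRight b).map_eq_zero_iff.1 (Finsupp.ext fun i => ?_)
  rw [TensorProduct.equivFinsuppOfBasisRight_apply, h, Finsupp.zero_apply]

/-- The dual of a vector space `C`. When `C` is a coalgebra, it is an algebra under convolution,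
`(a * b) c = a c₁ * b c₂`. -/
abbrev ConvDual (k C : Type*) [Field k] [AddCommGroup C] [Module k C] :=
  WithConv (C →ₗ[k] k)

variable {C : Type*} [AddCommGroup C] [Module k C]

theorem eq_of_forall_ofConv_eq {c d : C} (h : ∀ a : ConvDual k C, a.ofConv c = a.ofConv d) :
    c = d := by
  rw [← sub_eq_zero, ← Module.forall_dual_apply_eq_zero_iff k]
  exact fun f => by rw [map_sub, sub_eq_zero]; exact h (WithConv.toConv f)

variable [Coalgebra k C]

/-- The left action `c ↦ c₁ a(c₂)` of the convolution algebra on the coalgebra. -/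
noncomputable def leftHit : ConvDual k C →ₗ[k] Module.End k C where
  toFun a := (TensorProduct.rid k C).toLinearMap ∘ₗ a.ofConv.lTensor C ∘ₗ Coalgebra.comul
  map_add' a b := LinearMap.ext fun c => by simp [LinearMap.lTensor_add]
  map_smul' r a := LinearMap.ext fun c => by simp [LinearMap.lTensor_smul]

/-- The right action `c ↦ a(c₁) c₂` of the convolution algebra on the coalgebra. As it is a right
action, `rightHit (a * b) = rightHit b ∘ rightHit a`. -/
noncomputable def rightHit : ConvDual k C →ₗ[k] Module.End k C where
  toFun a := (TensorProduct.lid k C).toLinearMap ∘ₗ a.ofConv.rTensor C ∘ₗ Coalgebra.comul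
  map_add' a b := LinearMap.ext fun c => by simp [LinearMap.rTensor_add]
  map_smul' r a := LinearMap.ext fun c => by simp [LinearMap.rTensor_smul]

theorem leftHit_apply (a : ConvDual k C) (c : C) :
    leftHit a c = TensorProduct.rid k C (a.ofConv.lTensor C (Coalgebra.comul c)) := rfl

theorem rightHit_apply (a : ConvDual k C) (c : C) :
    rightHit a c = TensorProduct.lid k C (a.ofConv.rTensor C (Coalgebra.comul c)) := rfl

theorem ofConv_leftHit (a b : ConvDual k C) (c : C) :
    a.ofConv (leftHit b c) = (a * b).ofConv c := by
  rw [LinearMap.convMul_apply, leftHit_apply]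
  induction Coalgebra.comul (R := k) c with
  | zero => simp
  | add x y hx hy => simp only [map_add, hx, hy]
  | tmul x y => simp [mul_comm]

theorem ofConv_rightHit (a b : ConvDual k C) (c : C) :
    b.ofConv (rightHit a c) = (a * b).ofConv c := by
  rw [LinearMap.convMul_apply, rightHit_apply]
  induction Coalgebra.comul (R := k) c with
  | zero => simp
  | add x y hx hy => simp only [map_add, hx, hy]
  | tmul x y => simp

theorem leftHit_mul (a b : ConvDual k C) : leftHit (a * b) = leftHit a * leftHit b :=
  LinearMap.ext fun _ => eq_of_forall_ofConv_eq (k := k) fun _ => by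
    simp only [Module.End.mul_apply, ofConv_leftHit, mul_assoc]

theorem rightHit_mul (a b : ConvDual k C) : rightHit (a * b) = rightHit b * rightHit a :=
  LinearMap.ext fun _ => eq_of_forall_ofConv_eq (k := k) fun _ => by
    simp only [Module.End.mul_apply, ofConv_rightHit, mul_assoc]

theorem leftHit_one : leftHit (1 : ConvDual k C) = 1 :=
  LinearMap.ext fun _ => eq_of_forall_ofConv_eq (k := k) fun _ => by
    rw [ofConv_leftHit, mul_one, Module.End.one_apply]

theorem rightHit_one : rightHit (1 : ConvDual k C) = 1 :=
  LinearMap.ext fun _ => eq_of_forall_ofConv_eq (k := k) fun _ => by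
    rw [ofConv_rightHit, one_mul, Module.End.one_apply]

theorem rightHit_pow (a : ConvDual k C) (n : ℕ) : rightHit (a ^ n) = rightHit a ^ n := by
  induction n with
  | zero => exact rightHit_one
  | succ n ih => rw [pow_succ, pow_succ', rightHit_mul, ih]

theorem leftHit_rightHit (a b : ConvDual k C) (c : C) :
    leftHit a (rightHit b c) = rightHit b (leftHit a c) :=
  eq_of_forall_ofConv_eq (k := k) fun _ => by
    simp only [ofConv_leftHit, ofConv_rightHit, mul_assoc]

theorem ofConv_one_rightHit (a : ConvDual k C) (c : C) :
    (1 : ConvDual k C).ofConv (rightHit a c) = a.ofConv c := by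
  rw [ofConv_rightHit, mul_one]

theorem ofConv_eq_zero_of_rightHit {a : ConvDual k C} {c : C} (h : rightHit a c = 0) :
    a.ofConv c = 0 := by
  rw [← ofConv_one_rightHit, h, map_zero]

theorem isRightCoideal_iff {N : Submodule k C} :
    IsRightCoideal k N ↔ ∀ a : ConvDual k C, ∀ c ∈ N, leftHit a c ∈ N := by
  have hN (w : C ⊗[k] C) : N.mkQ.rTensor C w = 0 ↔
      ∀ f : C →ₗ[k] k, TensorProduct.rid k C (f.lTensor C w) ∈ N := by
    have rid_mkQ (f : C →ₗ[k] k) : TensorProduct.rid k _ (f.lTensor _ (N.mkQ.rTensor C w)) =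
        N.mkQ (TensorProduct.rid k C (f.lTensor C w)) := by
      induction w with
      | zero => simp
      | add y z hy hz => simp only [map_add, hy, hz]
      | tmul y z => simp
    simp only [← N.ker_mkQ, LinearMap.mem_ker, ← rid_mkQ]
    exact ⟨fun h f => by rw [h, map_zero, map_zero], eq_zero_of_forall_lTensor_eq_zero⟩
  have exact : Function.Exact (N.subtype.rTensor C) (N.mkQ.rTensor C) :=
    rTensor_exact C (LinearMap.exact_subtype_mkQ N) N.mkQ_surjective
  refine ⟨fun h a c hc => (hN _).1 ((exact _).2 (h c hc)) a.ofConv, fun h c hc => ?_⟩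
  exact (exact _).1 ((hN _).2 fun f => h (WithConv.toConv f) c hc)

/-- The right coideal generated by an element, namely its orbit under the left action of the
convolution algebra. -/
noncomputable def orbit (k : Type*) {C : Type*} [Field k] [AddCommGroup C] [Module k C]
    [Coalgebra k C] (c : C) : Submodule k C :=
  LinearMap.range (leftHit.flip c : ConvDual k C →ₗ[k] C)

theorem mem_orbit_self (c : C) : c ∈ orbit k c :=
  ⟨1, by rw [LinearMap.flip_apply, leftHit_one, Module.End.one_apply]⟩

theorem isRightCoideal_orbit (c : C) : IsRightCoideal k (orbit k c) := by
  rw [isRightCoideal_iff]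
  rintro a _ ⟨b, rfl⟩
  exact ⟨a * b, by simp only [LinearMap.flip_apply, leftHit_mul, Module.End.mul_apply]⟩

instance finiteDimensional_orbit (c : C) : FiniteDimensional k (orbit k c) := by
  classical
  let R := Coalgebra.Repr.arbitrary k c
  suffices orbit k c ≤ Submodule.span k (R.index.image R.left : Set C) from
    Submodule.finiteDimensional_of_le this
  rintro _ ⟨a, rfl⟩
  rw [LinearMap.flip_apply, leftHit_apply, ← R.eq]
  simp only [map_sum, LinearMap.lTensor_tmul, TensorProduct.rid_tmul]
  exact Submodule.sum_mem _ fun i hi => Submodule.smul_mem _ _ <| Submodule.subset_span <|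
    Finset.mem_coe.2 (Finset.mem_image_of_mem _ hi)

theorem isRightCoideal_ker_rightHit (a : ConvDual k C) :
    IsRightCoideal k (LinearMap.ker (rightHit a)) :=
  isRightCoideal_iff.2 fun b c hc => by
    rw [LinearMap.mem_ker] at hc ⊢
    rw [← leftHit_rightHit, hc, map_zero]

theorem isRightCoideal_range_rightHit (a : ConvDual k C) :
    IsRightCoideal k (LinearMap.range (rightHit a)) := by
  rw [isRightCoideal_iff]
  rintro b _ ⟨c, rfl⟩
  exact ⟨leftHit b c, (leftHit_rightHit b a c).symm⟩

theorem ker_rightHit_ne_top {a : ConvDual k C} (ha : a ≠ 0) : LinearMap.ker (rightHit a) ≠ ⊤ :=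
  fun h => ha <| WithConv.ext <| LinearMap.ext fun _ =>
    ofConv_eq_zero_of_rightHit (LinearMap.mem_ker.1 (h ▸ Submodule.mem_top))

theorem dvd_iff_of_surjective_rightHit {a : ConvDual k C} (ha : Function.Surjective (rightHit a))
    {b : ConvDual k C} : a ∣ b ↔ ∀ c, rightHit a c = 0 → b.ofConv c = 0 := by
  refine ⟨?_, fun h => ?_⟩
  · rintro ⟨u, rfl⟩ c hc
    rw [← ofConv_rightHit, hc, map_zero]
  · obtain ⟨r, hr⟩ := (rightHit a).exists_rightInverse_of_surjective (LinearMap.range_eq_top.2 ha)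
    refine ⟨WithConv.toConv (b.ofConv ∘ₗ r), WithConv.ext (LinearMap.ext fun c => ?_)⟩
    rw [← ofConv_rightHit, ← sub_eq_zero, WithConv.ofConv_toConv, LinearMap.comp_apply, ← map_sub]
    refine h _ ?_
    rw [map_sub, sub_eq_zero]
    exact (LinearMap.congr_fun hr _).symm

end ConvDual

section ChainTheory

theorem exists_linearMap_eqOn_of_monotone {k V W : Type*} [Field k] [AddCommGroup V] [Module k V]
    [AddCommGroup W] [Module k W] {K : ℕ → Submodule k V} (hK : Monotone K)
    (exhaust : ∀ v, ∃ n, v ∈ K n) {f : ℕ → V →ₗ[k] W}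
    (hf : ∀ n, Set.EqOn (f (n + 1)) (f n) (K n)) :
    ∃ g : V →ₗ[k] W, ∀ n, Set.EqOn g (f n) (K n) := by
  have stable {n m : ℕ} (hnm : n ≤ m) : Set.EqOn (f m) (f n) (K n) := by
    induction m, hnm using Nat.le_induction with
    | base => exact Set.eqOn_refl _ _
    | succ m hm ih => exact fun v hv => (hf m (hK hm hv)).trans (ih hv)
  choose N hN using exhaust
  have hg (n) : Set.EqOn (fun v => f (N v) v) (f n) (K n) := fun v hv =>
    (le_total n (N v)).elim (fun h => stable h hv) fun h => (stable h (hN v)).symm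
  refine ⟨⟨⟨fun v => f (N v) v, fun v w => ?_⟩, fun r v => ?_⟩, hg⟩
  · have hv := hK (le_max_left (N v) (N w)) (hN v)
    have hw := hK (le_max_right (N v) (N w)) (hN w)
    exact (hg _ (add_mem hv hw)).trans ((map_add _ v w).trans
      (congrArg₂ (· + ·) (hg _ hv) (hg _ hw)).symm)
  · exact (hg _ (Submodule.smul_mem _ r (hN v))).trans (map_smul _ r v)

theorem strictMono_ker_pow {k V : Type*} [Field k] [AddCommGroup V] [Module k V]
    {y : Module.End k V} (hy : Function.Surjective y) (hker : LinearMap.ker y ≠ ⊥) :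
    StrictMono fun n => LinearMap.ker (y ^ n) := by
  obtain ⟨v, hv, hv0⟩ := Submodule.exists_mem_ne_zero_of_ne_bot hker
  refine strictMono_nat_of_lt_succ fun n =>
    SetLike.lt_iff_le_and_exists.2 ⟨y.iterateKer.monotone n.le_succ, ?_⟩
  obtain ⟨w, rfl⟩ : ∃ w, (y ^ n) w = v := by
    rw [Module.End.coe_pow]
    exact hy.iterate n v
  exact ⟨w, by rwa [LinearMap.mem_ker, pow_succ', Module.End.mul_apply], hv0⟩

theorem finiteDimensional_of_surjective_of_ker_le {k V W X : Type*} [Field k] [AddCommGroup V]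
    [Module k V] [AddCommGroup W] [Module k W] [FiniteDimensional k W] [AddCommGroup X]
    [Module k X] (f : V →ₗ[k] W) {g : V →ₗ[k] X} (hg : Function.Surjective g)
    (h : LinearMap.ker f ≤ LinearMap.ker g) : FiniteDimensional k X := by
  have := f.quotKerEquivRange.symm.finiteDimensional
  refine Module.Finite.of_surjective ((LinearMap.ker f).liftQ g h) ?_
  rwa [← LinearMap.range_eq_top, Submodule.range_liftQ, LinearMap.range_eq_top]

namespace IsChainCoalgebra

variable {k C : Type*} [Field k] [AddCommGroup C] [Module k C] [Coalgebra k C]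
  (hC : IsChainCoalgebra k C)

include hC

theorem finiteDimensional_of_ne_top {N : Submodule k C} (hN : IsRightCoideal k N) (hne : N ≠ ⊤) :
    FiniteDimensional k N := by
  obtain ⟨c, -, hc⟩ := SetLike.exists_of_lt hne.lt_top
  rcases hC N (orbit k c) hN (isRightCoideal_orbit c) with h | h
  · exact Submodule.finiteDimensional_of_le h
  · exact absurd (h (mem_orbit_self c)) hc

theorem finiteDimensional_ker_rightHit {a : ConvDual k C} (ha : a ≠ 0) :
    FiniteDimensional k (LinearMap.ker (rightHit a)) :=
  hC.finiteDimensional_of_ne_top (isRightCoideal_ker_rightHit a) (ker_rightHit_ne_top ha)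

theorem surjective_rightHit (hinf : ¬ FiniteDimensional k C) {a : ConvDual k C} (ha : a ≠ 0) :
    Function.Surjective (rightHit a) := by
  by_contra hs
  have := hC.finiteDimensional_ker_rightHit ha
  have := hC.finiteDimensional_of_ne_top (isRightCoideal_range_rightHit a)
    (mt LinearMap.range_eq_top.1 hs)
  have := (rightHit a).quotKerEquivRange.symm.finiteDimensional
  exact hinf (Module.Finite.of_submodule_quotient (LinearMap.ker (rightHit a)))

theorem isDomain_convDual (hinf : ¬ FiniteDimensional k C) : IsDomain (ConvDual k C) := by
  have : Nontrivial (ConvDual k C) := not_subsingleton_iff_nontrivial.1 fun h => by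
    have : Subsingleton C := ⟨fun c d => eq_of_forall_ofConv_eq (k := k) fun a => by
      rw [h.elim a 0]
      rfl⟩
    exact hinf inferInstance
  have : NoZeroDivisors (ConvDual k C) := ⟨fun {a b} hab => by
    refine or_iff_not_imp_left.2 fun ha => WithConv.ext (LinearMap.ext fun c => ?_)
    obtain ⟨d, rfl⟩ := hC.surjective_rightHit hinf ha c
    rw [ofConv_rightHit, hab]
    rfl⟩
  exact NoZeroDivisors.to_isDomain _

theorem isUnit_iff_ker_rightHit_eq_bot (hinf : ¬ FiniteDimensional k C) {a : ConvDual k C} :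
    IsUnit a ↔ LinearMap.ker (rightHit a) = ⊥ := by
  rw [LinearMap.ker_eq_bot']
  refine ⟨?_, fun h => ?_⟩
  · rintro ⟨a, rfl⟩ c hc
    rw [← Module.End.one_apply (R := k) c, ← rightHit_one, ← a.mul_inv, rightHit_mul,
      Module.End.mul_apply, hc, map_zero]
  · have ha : a ≠ 0 := by
      rintro rfl
      have : Subsingleton C := subsingleton_of_forall_eq 0 fun c => h c (by simp)
      exact hinf inferInstance
    have := hC.isDomain_convDual hinf
    obtain ⟨b, hb⟩ := (dvd_iff_of_surjective_rightHit (hC.surjective_rightHit hinf ha)).2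
      fun c hc => (congrArg (1 : ConvDual k C).ofConv (h c hc)).trans (map_zero _)
    exact .of_mul_eq_one b hb.symm

theorem not_isUnit_add (hinf : ¬ FiniteDimensional k C) {a b : ConvDual k C} (ha : ¬ IsUnit a)
    (hb : ¬ IsUnit b) : ¬ IsUnit (a + b) := by
  wlog hab : LinearMap.ker (rightHit a) ≤ LinearMap.ker (rightHit b) generalizing a b
  · rw [add_comm]
    exact this hb ha <| (hC _ _ (isRightCoideal_ker_rightHit b)
      (isRightCoideal_ker_rightHit a)).resolve_right hab
  rw [hC.isUnit_iff_ker_rightHit_eq_bot hinf] at ha ⊢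
  refine mt (fun h => ?_) ha
  rw [eq_bot_iff, ← h]
  intro c hc
  rw [LinearMap.mem_ker, map_add, LinearMap.add_apply, hc, hab hc, add_zero]

/-- The maximal ideal of the convolution algebra of an infinite-dimensional chain coalgebra. -/
def nonunitsIdeal (hinf : ¬ FiniteDimensional k C) : Ideal (ConvDual k C) where
  carrier := nonunits (ConvDual k C)
  add_mem' := hC.not_isUnit_add hinf
  zero_mem' :=
    have := hC.isDomain_convDual hinf
    not_isUnit_zero
  smul_mem' _ _ ha hba :=
    have := hC.isDomain_convDual hinf
    ha (IsUnit.mul_iff.1 hba).2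

theorem exists_pow_rightHit_eq_zero (hinf : ¬ FiniteDimensional k C) {a : ConvDual k C}
    (ha : ¬ IsUnit a) (c : C) : ∃ n, (rightHit a ^ n) c = 0 := by
  rcases eq_or_ne a 0 with rfl | ha0
  · exact ⟨1, by simp⟩
  by_contra! hc
  have hle (n) : LinearMap.ker (rightHit a ^ n) ≤ orbit k c := by
    rw [← rightHit_pow]
    refine (hC _ _ (isRightCoideal_orbit c) (isRightCoideal_ker_rightHit _)).resolve_left
      fun h => ?_
    refine hc n (LinearMap.mem_ker.1 ?_)
    rw [← rightHit_pow]
    exact h (mem_orbit_self c)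
  have fin (n) := Submodule.finiteDimensional_of_le (hle n)
  have strict : StrictMono fun n => Module.finrank k (LinearMap.ker (rightHit a ^ n)) :=
    fun _ n hmn => Submodule.finrank_lt_finrank_of_lt <|
      strictMono_ker_pow (hC.surjective_rightHit hinf ha0)
        (mt (hC.isUnit_iff_ker_rightHit_eq_bot hinf).2 ha) hmn
  exact (strict.le_apply.trans (Submodule.finrank_mono (hle _))).not_gt (Nat.lt_succ_self _)

theorem exists_ne_zero_not_isUnit (hinf : ¬ FiniteDimensional k C) :
    ∃ a : ConvDual k C, a ≠ 0 ∧ ¬ IsUnit a := by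
  obtain ⟨c, hc⟩ : ∃ c : C, c ≠ 0 := by
    by_contra! h
    have := subsingleton_of_forall_eq 0 h
    exact hinf inferInstance
  obtain ⟨d, -, hd⟩ := SetLike.exists_of_lt <| lt_top_iff_ne_top.2 fun h : orbit k c = ⊤ =>
    hinf (Module.finite_def.2 (h ▸ Module.Finite.iff_fg.1 (finiteDimensional_orbit c)))
  obtain ⟨f, hf, hfc⟩ := Submodule.exists_dual_map_eq_bot_of_notMem hd inferInstance
  refine ⟨WithConv.toConv f, fun h => hf (congrArg (fun g : ConvDual k C => g.ofConv d) h), ?_⟩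
  rw [hC.isUnit_iff_ker_rightHit_eq_bot hinf, LinearMap.ker_eq_bot']
  refine fun h => hc (h c (eq_of_forall_ofConv_eq (k := k) fun a => ?_))
  rw [ofConv_rightHit, ← ofConv_leftHit, map_zero, ← Submodule.mem_bot k, ← hfc]
  exact Submodule.mem_map_of_mem ⟨a, rfl⟩

theorem exists_forall_not_isUnit_iff_dvd (hinf : ¬ FiniteDimensional k C) :
    ∃ x : ConvDual k C, x ≠ 0 ∧ ∀ a, ¬ IsUnit a ↔ x ∣ a := by
  obtain ⟨x, ⟨hx0, hx⟩, hmin⟩ := exists_minimalFor_of_wellFoundedLT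
    (fun a : ConvDual k C => a ≠ 0 ∧ ¬ IsUnit a)
    (fun a => Module.finrank k (LinearMap.ker (rightHit a))) (hC.exists_ne_zero_not_isUnit hinf)
  have := hC.isDomain_convDual hinf
  refine ⟨x, hx0, fun a => ⟨fun ha => ?_, ?_⟩⟩
  · rcases eq_or_ne a 0 with rfl | ha0
    · exact dvd_zero x
    have := hC.finiteDimensional_ker_rightHit hx0
    have hle : LinearMap.ker (rightHit x) ≤ LinearMap.ker (rightHit a) :=
      (hC _ _ (isRightCoideal_ker_rightHit x) (isRightCoideal_ker_rightHit a)).elim id fun h =>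
        (Submodule.eq_of_le_of_finrank_le h (hmin ⟨ha0, ha⟩ (Submodule.finrank_mono h))).ge
    exact (dvd_iff_of_surjective_rightHit (hC.surjective_rightHit hinf hx0)).2 fun c hc =>
      ofConv_eq_zero_of_rightHit (hle hc)
  · rintro ⟨b, rfl⟩ h
    exact hx (IsUnit.mul_iff.1 h).1

section Residue

variable {D : Type*} [Ring D] [Algebra k D] {q : ConvDual k C →ₐ[k] D}

theorem exists_isUniformizer (hinf : ¬ FiniteDimensional k C) (hq : ∀ a, q a = 0 ↔ ¬ IsUnit a) :
    ∃ x, IsUniformizer q x := by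
  have := hC.isDomain_convDual hinf
  obtain ⟨x, hx0, hx⟩ := hC.exists_forall_not_isUnit_iff_dvd hinf
  exact ⟨x, IsLeftCancelMulZero.mul_left_cancel_of_ne_zero hx0, fun a => (hq a).trans (hx a)⟩

theorem finiteDimensional_residue (hinf : ¬ FiniteDimensional k C)
    (hq : ∀ a, q a = 0 ↔ ¬ IsUnit a) (hsurj : Function.Surjective q) : FiniteDimensional k D := by
  obtain ⟨x, hx0, hx⟩ := hC.exists_forall_not_isUnit_iff_dvd hinf
  have := hC.finiteDimensional_ker_rightHit hx0
  let restrict : ConvDual k C →ₗ[k] Module.Dual k (LinearMap.ker (rightHit x)) :=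
    (LinearMap.ker (rightHit x)).dualRestrict ∘ₗ (WithConv.linearEquiv k _).toLinearMap
  refine finiteDimensional_of_surjective_of_ker_le restrict (g := q.toLinearMap) hsurj
    fun a ha => ?_
  exact (hq a).2 <| (hx a).2 <|
    (dvd_iff_of_surjective_rightHit (hC.surjective_rightHit hinf hx0)).2 fun c hc =>
      LinearMap.congr_fun (LinearMap.mem_ker.1 ha) ⟨c, hc⟩

theorem isAdicallyComplete_ker (hinf : ¬ FiniteDimensional k C)
    (hq : ∀ a, q a = 0 ↔ ¬ IsUnit a) : IsAdicallyComplete (RingHom.ker q) := by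
  have := hC.isDomain_convDual hinf
  obtain ⟨x, hx⟩ := hC.exists_isUniformizer hinf hq
  have hx0 : x ≠ 0 := hx.isLeftRegular.ne_zero
  have exhaust := hC.exists_pow_rightHit_eq_zero hinf
    ((hq x).1 ((hx.map_eq_zero_iff x).2 dvd_rfl))
  have mem_pow (n) (a : ConvDual k C) : a ∈ RingHom.ker q ^ n ↔
      ∀ c ∈ LinearMap.ker (rightHit x ^ n), a.ofConv c = 0 := by
    rw [hx.mem_ker_pow_iff, ← rightHit_pow]
    exact dvd_iff_of_surjective_rightHit (hC.surjective_rightHit hinf (pow_ne_zero n hx0))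
  refine ⟨fun a ha => WithConv.ext (LinearMap.ext fun c => ?_), fun a ha => ?_⟩
  · obtain ⟨n, hn⟩ := exhaust c
    exact (mem_pow n a).1 (ha n) c hn
  · obtain ⟨l, hl⟩ := exists_linearMap_eqOn_of_monotone (rightHit x).iterateKer.monotone exhaust
      (f := fun n => (a n).ofConv) fun n c hc => sub_eq_zero.1 ((mem_pow n _).1 (ha n) c hc)
    exact ⟨WithConv.toConv l, fun n => (mem_pow n _).2 fun c hc => sub_eq_zero.2 (hl n hc)⟩

end Residue

end IsChainCoalgebra

theorem IsChainCoalgebra.exists_algHom_residue {k : Type u} {C : Type v} [Field k]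
    [AddCommGroup C] [Module k C] [Coalgebra k C] (hC : IsChainCoalgebra k C)
    (hinf : ¬ FiniteDimensional k C) :
    ∃ (D : Type u) (_ : DivisionRing D) (_ : Algebra k D) (_ : FiniteDimensional k D)
      (q : ConvDual k C →ₐ[k] D), Function.Surjective q ∧ ∀ a, q a = 0 ↔ ¬ IsUnit a := by
  have := hC.isDomain_convDual hinf
  let J := hC.nonunitsIdeal hinf
  have : J.IsTwoSided := ⟨fun b ha hab => ha (IsUnit.mul_iff.1 hab).1⟩
  have mk_eq_zero_iff (a) : Ideal.Quotient.mkₐ k J a = 0 ↔ ¬ IsUnit a :=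
    Ideal.Quotient.eq_zero_iff_mem
  have : Nontrivial (ConvDual k C ⧸ J) :=
    Ideal.Quotient.nontrivial_iff.2 (J.ne_top_iff_one.2 fun h => h isUnit_one)
  let _ : DivisionRing (ConvDual k C ⧸ J) := .ofIsUnitOrEqZero fun a => by
    obtain ⟨a, rfl⟩ := Ideal.Quotient.mk_surjective a
    exact (em (IsUnit a)).imp (IsUnit.map _) (mk_eq_zero_iff a).2
  have := hC.finiteDimensional_residue hinf mk_eq_zero_iff Ideal.Quotient.mk_surjective
  have : Small.{u} (ConvDual k C ⧸ J) := Module.Finite.small.{u} k _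
  let e : Shrink.{u} (ConvDual k C ⧸ J) ≃ₐ[k] (ConvDual k C ⧸ J) := Shrink.algEquiv k _
  exact ⟨_, inferInstance, inferInstance, e.symm.toLinearEquiv.finiteDimensional,
    e.symm.toAlgHom.comp (Ideal.Quotient.mkₐ k J),
    e.symm.surjective.comp Ideal.Quotient.mk_surjective,
    fun a => (map_eq_zero_iff e.symm e.symm.injective).trans (mk_eq_zero_iff a)⟩

end ChainTheory

section CotensorLift

open TensorProduct (assoc map)

variable {k : Type*} [Field k]

section DirectSum

variable {I : Type*} {M N : I → Type*} [∀ i, AddCommGroup (M i)]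
  [∀ i, Module k (M i)] [∀ i, AddCommGroup (N i)] [∀ i, Module k (N i)]

theorem exists_linearMap_component_eq {V : Type*} [AddCommGroup V] [Module k V]
    (f : ∀ i, V →ₗ[k] M i) (hf : ∀ v, {i | f i v ≠ 0}.Finite) :
    ∃ F : V →ₗ[k] DirectSum I M, ∀ i v, DirectSum.component k I M i (F v) = f i v := by
  classical
  have exists_components (v : V) : ∃ t : DirectSum I M, ∀ i, t i = f i v :=
    ⟨DFinsupp.mk (hf v).toFinset fun i => f i v, fun i => by
      by_cases h : f i v = 0 <;> simp [DFinsupp.mk_apply, h]⟩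
  choose F hF using exists_components
  exact ⟨{ toFun := F
           map_add' := fun v w => DFinsupp.ext fun i =>
            (hF _ i).trans (by rw [map_add, DFinsupp.add_apply, hF, hF])
           map_smul' := fun r v => DFinsupp.ext fun i =>
            (hF _ i).trans (by rw [map_smul, RingHom.id_apply, DFinsupp.smul_apply, hF]) },
    fun i v => hF v i⟩

theorem directSum_tensor_ext {w w' : DirectSum I M ⊗[k] DirectSum I N}
    (h : ∀ i j, map (DirectSum.component k I M i) (DirectSum.component k I N j) w =
      map (DirectSum.component k I M i) (DirectSum.component k I N j) w') : w = w' := by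
  classical
  have directSumLeft_apply (i) (w : DirectSum I M ⊗[k] DirectSum I N) :
      TensorProduct.directSumLeft k k M _ w i = (DirectSum.component k I M i).rTensor _ w := by
    induction w with
    | zero => simp
    | add x y hx hy => simp only [map_add, DirectSum.add_apply, hx, hy]
    | tmul x y => rw [TensorProduct.directSumLeft_tmul]; rfl
  have directSumRight_apply (i j) (w : M i ⊗[k] DirectSum I N) :
      TensorProduct.directSumRight k k _ N w j = (DirectSum.component k I N j).lTensor _ w := by
    induction w with
    | zero => simp
    | add x y hx hy => simp only [map_add, DirectSum.add_apply, hx, hy]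
    | tmul x y => rw [TensorProduct.directSumRight_tmul]; rfl
  refine (TensorProduct.directSumLeft k k M _).injective (DFinsupp.ext fun i =>
    (TensorProduct.directSumRight k k _ N).injective (DFinsupp.ext fun j => ?_))
  simp only [directSumLeft_apply, directSumRight_apply, ← LinearMap.comp_apply,
    LinearMap.lTensor_comp_rTensor, h]

end DirectSum

theorem assoc_rTensor_map_comul {C X Y Z Q : Type*} [AddCommGroup C] [Module k C] [Coalgebra k C]
    [AddCommGroup X] [Module k X] [AddCommGroup Y] [Module k Y] [AddCommGroup Z] [Module k Z]
    [AddCommGroup Q] [Module k Q] {r : X →ₗ[k] Y ⊗[k] Z} {a : C →ₗ[k] X} {b : C →ₗ[k] Y}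
    {c : C →ₗ[k] Z} (h : r ∘ₗ a = map b c ∘ₗ Coalgebra.comul) (f : C →ₗ[k] Q) (x : C) :
    assoc k Y Z Q (r.rTensor Q (map a f (Coalgebra.comul x))) =
      map b (map c f ∘ₗ Coalgebra.comul) (Coalgebra.comul x) := by
  rw [LinearMap.rTensor_map, h, ← LinearMap.map_rTensor, ← TensorProduct.map_map_assoc,
    Coalgebra.coassoc_apply, LinearMap.map_lTensor]

universe w

variable {E M : Type w} [AddCommGroup E] [Module k E] [Coalgebra k E] [AddCommGroup M] [Module k M]

namespace CotensorCoalgebra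

variable (B : Bicomodule k E M)

/-- The projection of `T_E(M)` onto the `n`-th cotensor power. -/
noncomputable def proj (n : ℕ) : CotensorCoalgebra B →ₗ[k] (B.power n).carrier :=
  DirectSum.component k ℕ (fun m => (B.power m).carrier) n

variable {B}

theorem proj_ι_self (n : ℕ) (t : (B.power n).carrier) : proj B n (ι B n t) = t :=
  DirectSum.component.lof_self k (M := fun m => (B.power m).carrier) n t

theorem proj_ι_of_ne {m n : ℕ} (h : m ≠ n) (t : (B.power m).carrier) : proj B n (ι B m t) = 0 :=
  (DirectSum.component.of k (M := fun m => (B.power m).carrier) n m t).trans (dif_neg h)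

theorem ext_proj {x y : CotensorCoalgebra B} (h : ∀ n, proj B n x = proj B n y) : x = y :=
  DFinsupp.ext h

theorem tensor_ext_proj {w w' : CotensorCoalgebra B ⊗[k] CotensorCoalgebra B}
    (h : ∀ i j, map (proj B i) (proj B j) w = map (proj B i) (proj B j) w') : w = w' :=
  directSum_tensor_ext (M := fun n => (B.power n).carrier) (N := fun n => (B.power n).carrier) h

theorem map_proj_proj_comul (i j : ℕ) (x : CotensorCoalgebra B) :
    map (proj B i) (proj B j) (Coalgebra.comul (R := k) x) =
      (B.split i j).1 (proj B (j + i) x) := by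
  suffices h : map (proj B i) (proj B j) ∘ₗ Coalgebra.comul = (B.split i j).1 ∘ₗ proj B (j + i) from
    LinearMap.congr_fun h x
  refine hom_ext fun n => LinearMap.ext fun t => ?_
  have part_eq_zero (hn : i + j ≠ n) : B.part i j n t = 0 := by
    refine (congrArg (B.split i j).1 (proj_ι_of_ne (by omega) t)).trans (map_zero _)
  have map_proj_part (p : ℕ × ℕ) (hp : p ≠ (i, j)) :
      map (proj B i) (proj B j) (map (ι B p.1) (ι B p.2) (B.part p.1 p.2 n t)) = 0 := by
    have proj_comp_ι {m l} (h : m ≠ l) : proj B l ∘ₗ ι B m = 0 :=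
      LinearMap.ext (proj_ι_of_ne h)
    rw [TensorProduct.map_map]
    rcases not_and_or.1 (mt Prod.ext_iff.2 hp) with h | h <;> simp [proj_comp_ι h]
  have map_proj_part_self :
      map (proj B i) (proj B j) (map (ι B i) (ι B j) (B.part i j n t)) = B.part i j n t := by
    have proj_comp_ι (l) : proj B l ∘ₗ ι B l = LinearMap.id := LinearMap.ext (proj_ι_self l)
    rw [TensorProduct.map_map, proj_comp_ι, proj_comp_ι, TensorProduct.map_id, LinearMap.id_apply]
  refine (congrArg (map (proj B i) (proj B j)) (comul_ι B n t)).trans ((map_sum ..).trans ?_)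
  refine (Finset.sum_eq_single (i, j) (fun p _ hp => map_proj_part p hp) fun hij => ?_).trans
    map_proj_part_self
  rw [map_proj_part_self, part_eq_zero (by simpa using hij)]

end CotensorCoalgebra

/-- A coalgebra map `π : C → E` together with a map `g : C → M` to an `E`-bicomodule that is
bicolinear along `π`: the data defining a coalgebra map from `C` to the cotensor coalgebra. -/
structure BicolinearPair (B : Bicomodule k E M) (C : Type*) [AddCommGroup C] [Module k C]
    [Coalgebra k C] where
  π : C →ₗc[k] E
  g : C →ₗ[k] M
  left_comp_g : B.left ∘ₗ g = map π.toLinearMap g ∘ₗ Coalgebra.comul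
  right_comp_g : B.right ∘ₗ g = map g π.toLinearMap ∘ₗ Coalgebra.comul

namespace BicolinearPair

variable {B : Bicomodule k E M} {C : Type*} [AddCommGroup C] [Module k C] [Coalgebra k C]

variable (P : BicolinearPair B C)

/-- The map `g □ f : C → M □ N`, `c ↦ g(c₁) □ f(c₂)`, for `f` left colinear along `π`. -/
noncomputable def cotensorLift {N : Type w} [AddCommGroup N] [Module k N] {l : N →ₗ[k] E ⊗[k] N}
    (f : C →ₗ[k] N) (hf : l ∘ₗ f = map P.π.toLinearMap f ∘ₗ Coalgebra.comul) :
    C →ₗ[k] cotensor B.right l :=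
  (map P.g f ∘ₗ Coalgebra.comul).codRestrict _ fun c => by
    refine (assoc_rTensor_map_comul P.right_comp_g f c).trans ?_
    rw [← hf, ← LinearMap.lTensor_map, LinearMap.comp_apply]

theorem cotensorCoact_comp_cotensorLift {N : Type w} [AddCommGroup N] [Module k N]
    {l : N →ₗ[k] E ⊗[k] N} {f : C →ₗ[k] N}
    (hf : l ∘ₗ f = map P.π.toLinearMap f ∘ₗ Coalgebra.comul) :
    cotensorCoact B l ∘ₗ P.cotensorLift f hf =
      map P.π.toLinearMap (P.cotensorLift f hf) ∘ₗ Coalgebra.comul := by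
  refine LinearMap.ext fun c => ?_
  apply lTensor_inj (Q := E) (Submodule.subtype_injective (cotensor B.right l))
  refine (subtype_cotensorCoact B l _).trans
    ((assoc_rTensor_map_comul P.left_comp_g f c).trans ?_)
  rw [LinearMap.comp_apply, LinearMap.lTensor_map]
  rfl

/-- The map `C → M^{□ n}` which is `π` for `n = 0` and `c ↦ g(c₁) □ ⋯ □ g(cₙ)` for `n > 0`,
together with the fact that it is left colinear along `π`. -/
noncomputable def power : (n : ℕ) →
    {f : C →ₗ[k] (B.power n).carrier //
      (B.power n).coact ∘ₗ f = map P.π.toLinearMap f ∘ₗ Coalgebra.comul}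
  | 0 => ⟨P.π.toLinearMap, P.π.map_comp_comul.symm⟩
  | 1 => ⟨P.g, P.left_comp_g⟩
  | n + 2 => ⟨P.cotensorLift (power (n + 1)).1 (power (n + 1)).2,
      P.cotensorCoact_comp_cotensorLift (power (n + 1)).2⟩

theorem split_comp_power (i j : ℕ) :
    (B.split i j).1 ∘ₗ (P.power (j + i)).1 =
      map (P.power i).1 (P.power j).1 ∘ₗ Coalgebra.comul := by
  match i, j with
  | 0, j => exact (P.power j).2
  | 1, 0 => exact P.right_comp_g
  | 1, j + 1 => rfl
  | i + 2, j =>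
    refine LinearMap.ext fun c => ?_
    have assoc_rTensor_subtype := assoc_rTensor_map_comul
      (r := (cotensor B.right (B.power (i + 1)).coact).subtype) (a := (P.power (i + 2)).1)
      rfl (P.power j).1 c
    rw [← split_comp_power (i + 1) j] at assoc_rTensor_subtype
    apply rTensor_inj (Q := (B.power j).carrier)
      (Submodule.subtype_injective (cotensor B.right (B.power (i + 1)).coact))
    refine (subtype_cotensorMap B.right (B.power (j + (i + 1))).coact (B.power (i + 1)).coact
      (B.split (i + 1) j).1 (B.split (i + 1) j).2 _).trans ((LinearEquiv.symm_apply_eq _).2 ?_)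
    exact (LinearMap.lTensor_map ..).trans assoc_rTensor_subtype.symm

theorem exists_proj_eq_power (hP : ∀ c, {n | (P.power n).1 c ≠ 0}.Finite) :
    ∃ F : C →ₗc[k] CotensorCoalgebra B, ∀ n c, CotensorCoalgebra.proj B n (F c) =
      (P.power n).1 c := by
  obtain ⟨F, hF⟩ : ∃ F : C →ₗ[k] CotensorCoalgebra B,
      ∀ n, CotensorCoalgebra.proj B n ∘ₗ F = (P.power n).1 := by
    obtain ⟨F, hF⟩ := exists_linearMap_component_eq (fun n => (P.power n).1) hP
    exact ⟨F, fun n => LinearMap.ext (hF n)⟩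
  refine ⟨{ F with counit_comp := ?_, map_comp_comul := ?_ }, fun n => LinearMap.congr_fun (hF n)⟩
  · exact (congrArg (B.counitZero ∘ₗ ·) (hF 0)).trans P.π.counit_comp
  · refine LinearMap.ext fun c => CotensorCoalgebra.tensor_ext_proj fun i j => ?_
    refine (TensorProduct.map_map ..).trans ?_
    rw [hF, hF, LinearMap.comp_apply, CotensorCoalgebra.map_proj_proj_comul]
    refine (LinearMap.congr_fun (P.split_comp_power i j) c).symm.trans ?_
    rw [← hF (j + i)]
    rfl

end BicolinearPair

end CotensorLift

section Recognition

section LocallyNilpotent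

variable {R V W : Type*} [Ring R] [AddCommGroup V] [Module R V] [AddCommGroup W] [Module R W]
  {y : Module.End R V} {p : V →ₗ[R] W}

theorem eq_zero_of_forall_apply_pow_eq_zero {v : V} (hnil : ∃ n, (y ^ n) v = 0)
    (hp : Function.Injective (p.domRestrict (LinearMap.ker y))) (hv : ∀ n, p ((y ^ n) v) = 0) :
    v = 0 := by
  obtain ⟨n, hn⟩ := hnil
  induction n with
  | zero => exact hn
  | succ n ih =>
    refine ih ?_
    rw [pow_succ', Module.End.mul_apply] at hn
    exact congrArg Subtype.val (@hp ⟨(y ^ n) v, hn⟩ 0 ((hv n).trans (map_zero _).symm))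

theorem exists_forall_apply_pow_eq (hy : Function.Surjective y)
    (hp : Function.Surjective (p.domRestrict (LinearMap.ker y))) {w : ℕ → W}
    (hw : {n | w n ≠ 0}.Finite) : ∃ v, ∀ n, p ((y ^ n) v) = w n := by
  obtain ⟨N, hN⟩ : ∃ N, ∀ n ≥ N, w n = 0 := by
    obtain ⟨N, hN⟩ := hw.bddAbove
    exact ⟨N + 1, fun n hn => not_not.1 fun h => absurd (hN h) (by omega)⟩
  clear hw
  induction N generalizing w with
  | zero => exact ⟨0, fun n => by rw [map_zero, map_zero, hN n n.zero_le]⟩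
  | succ N ih =>
    obtain ⟨v, hv⟩ := @ih (fun n => w (n + 1)) fun n hn => hN _ (Nat.succ_le_succ hn)
    obtain ⟨v, rfl⟩ := hy v
    obtain ⟨⟨u, hu⟩, hpu⟩ := hp (w 0 - p v)
    refine ⟨u + v, fun n => ?_⟩
    cases n with
    | zero => simpa [eq_sub_iff_add_eq] using hpu
    | succ n => rw [pow_succ, Module.End.mul_apply, map_add, LinearMap.mem_ker.1 hu, zero_add, hv]

end LocallyNilpotent

universe w

variable {k : Type u} [Field k]

section Contract

open TensorProduct (assoc)

variable {V N : Type*} [AddCommGroup V] [Module k V] [AddCommGroup N] [Module k N]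

/-- The contraction `V^* ⊗ N → N`, `f ⊗ n ↦ f(v) n`, with a vector `v`. -/
noncomputable def contract (v : V) : Module.Dual k V ⊗[k] N →ₗ[k] N :=
  (TensorProduct.lid k N).toLinearMap ∘ₗ (Module.Dual.eval k V v).rTensor N

@[simp]
theorem contract_tmul (v : V) (f : Module.Dual k V) (n : N) : contract v (f ⊗ₜ n) = f v • n := by
  simp [contract]

theorem eq_of_forall_contract_eq [FiniteDimensional k V] {t t' : Module.Dual k V ⊗[k] N}
    (h : ∀ v, contract v t = contract v t') : t = t' := by
  classical
  let b := Module.finBasis k V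
  refine (TensorProduct.equivFinsuppOfBasisLeft b.dualBasis).injective (Finsupp.ext fun i => ?_)
  have coord_dualBasis : b.dualBasis.coord i = Module.Dual.eval k V (b i) :=
    LinearMap.ext fun f => b.dualBasis_repr f i
  simp only [TensorProduct.equivFinsuppOfBasisLeft_apply, coord_dualBasis]
  exact h (b i)

variable {D M : Type w} [Ring D] [Algebra k D] [FiniteDimensional k D] [AddCommGroup M]
  [Module k M] [Module D M] [Module Dᵐᵒᵖ M] [SMulCommClass D Dᵐᵒᵖ M] [IsScalarTower k D M]
  [IsScalarTower k Dᵐᵒᵖ M] [FiniteDimensional k M]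

theorem contract_op_smul {N : Type (max u w)} [AddCommGroup N] [Module k N]
    {l : N →ₗ[k] Module.Dual k D ⊗[k] N} {t : Module.Dual k M ⊗[k] N}
    (ht : t ∈ cotensor (dualBicomodule k D M).right l) (b : D) (m : M) :
    contract (MulOpposite.op b • m) t = contract b (l (contract m t)) := by
  have contract_lTensor_assoc (n : N) (w : Module.Dual k M ⊗[k] Module.Dual k D) :
      contract m ((contract b).lTensor _ (assoc k _ _ N (w ⊗ₜ n))) =
        TensorProduct.dualDistribEquiv k M D w (m ⊗ₜ b) • n := by
    induction w with
    | zero => simp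
    | add x y hx hy => simp only [map_add, TensorProduct.add_tmul, hx, hy, LinearMap.add_apply,
        add_smul]
    | tmul f g => simp [smul_smul, mul_comm]
  have contract_op_smul_eq (t : Module.Dual k M ⊗[k] N) : contract (MulOpposite.op b • m) t =
      contract m ((contract b).lTensor _ (assoc k _ _ N
        ((dualBicomodule k D M).right.rTensor N t))) := by
    induction t with
    | zero => simp
    | add x y hx hy => simp only [map_add, hx, hy]
    | tmul f n =>
      rw [LinearMap.rTensor_tmul, contract_lTensor_assoc, contract_tmul]
      exact congrArg (· • n) ((dualDistribEquiv_dualSplit _ f _).trans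
        (congrArg f (rightAction_tmul k D M b m))).symm
  have contract_lTensor (t : Module.Dual k M ⊗[k] N) :
      contract m ((contract b).lTensor _ (l.lTensor _ t)) = contract b (l (contract m t)) := by
    induction t with
    | zero => simp
    | add x y hx hy => simp only [map_add, hx, hy]
    | tmul f n => simp
  rw [contract_op_smul_eq, ← contract_lTensor]
  exact congrArg (fun z => contract m ((contract b).lTensor _ z)) ht

variable {e : M}

theorem injective_contract_domRestrict_cotensor
    (he : Function.Surjective fun b : D => MulOpposite.op b • e) {N : Type (max u w)}
    [AddCommGroup N] [Module k N] (l : N →ₗ[k] Module.Dual k D ⊗[k] N) :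
    Function.Injective ((contract e).domRestrict (cotensor (dualBicomodule k D M).right l)) := by
  rintro ⟨t, ht⟩ ⟨t', ht'⟩ (h : contract e t = contract e t')
  refine Subtype.ext (eq_of_forall_contract_eq fun m => ?_)
  obtain ⟨b, rfl⟩ := he m
  simp only [contract_op_smul ht, contract_op_smul ht', h]

variable (k D e) in
/-- The map `(M^*)^{□ n} → D^*` that contracts every tensor factor with `e`, the last one with
`d ↦ e d`. -/
noncomputable def iterContract : (n : ℕ) →
    ((dualBicomodule k D M).power n).carrier →ₗ[k] Module.Dual k D
  | 0 => LinearMap.id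
  | 1 => ((LinearMap.toSpanSingleton Dᵐᵒᵖ M e).restrictScalars k ∘ₗ
      (MulOpposite.opLinearEquiv k).toLinearMap).dualMap
  | n + 2 => iterContract (n + 1) ∘ₗ (contract e).domRestrict
      (cotensor (dualBicomodule k D M).right ((dualBicomodule k D M).power (n + 1)).coact)

theorem injective_iterContract (he : Function.Surjective fun b : D => MulOpposite.op b • e) :
    ∀ n, Function.Injective (iterContract k D e n)
  | 0 => Function.injective_id
  | 1 => LinearMap.dualMap_injective_of_surjective he
  | n + 2 => (injective_iterContract he (n + 1)).comp (injective_contract_domRestrict_cotensor he _)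

end Contract

section Flip

open TensorProduct (map)

variable {C : Type v} [AddCommGroup C] [Module k C]

/-- The map `C → V^*` corresponding to a map `V → C^*`. -/
noncomputable def evalFlip {V : Type*} [AddCommGroup V] [Module k V] (f : V →ₗ[k] ConvDual k C) :
    C →ₗ[k] Module.Dual k V :=
  ((WithConv.linearEquiv k (C →ₗ[k] k)).toLinearMap ∘ₗ f).flip

theorem evalFlip_apply {V : Type*} [AddCommGroup V] [Module k V] (f : V →ₗ[k] ConvDual k C)
    (c : C) (v : V) : evalFlip f c v = (f v).ofConv c := rfl

variable [Coalgebra k C]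

theorem dualSplit_comp_evalFlip {X Y Z : Type w} [AddCommGroup X] [Module k X] [AddCommGroup Y]
    [Module k Y] [AddCommGroup Z] [Module k Z] [FiniteDimensional k X] [FiniteDimensional k Y]
    {μ : X ⊗[k] Y →ₗ[k] Z} {f : Z →ₗ[k] ConvDual k C} {g : X →ₗ[k] ConvDual k C}
    {h : Y →ₗ[k] ConvDual k C} (hμ : ∀ x y, f (μ (x ⊗ₜ y)) = g x * h y) :
    dualSplit μ ∘ₗ evalFlip f = map (evalFlip g) (evalFlip h) ∘ₗ Coalgebra.comul := by
  refine LinearMap.ext fun c => (TensorProduct.dualDistribEquiv k X Y).injective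
    (TensorProduct.ext' fun x y => ?_)
  rw [LinearMap.comp_apply, LinearMap.comp_apply, dualDistribEquiv_dualSplit, evalFlip_apply, hμ,
    LinearMap.convMul_apply]
  induction Coalgebra.comul (R := k) c with
  | zero => simp
  | add a b ha hb => simp only [map_add, LinearMap.add_apply, ha, hb]
  | tmul a b => rw [TensorProduct.map_tmul, TensorProduct.map_tmul, dualDistribEquiv_tmul]; rfl

theorem contract_map_evalFlip {V N : Type*} [AddCommGroup V] [Module k V] [AddCommGroup N]
    [Module k N] (f : V →ₗ[k] ConvDual k C) (g : C →ₗ[k] N) (v : V) (c : C) :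
    contract v (map (evalFlip f) g (Coalgebra.comul c)) = g (rightHit (f v) c) := by
  rw [rightHit_apply]
  induction Coalgebra.comul (R := k) c with
  | zero => simp
  | add a b ha hb => simp only [map_add, ha, hb]
  | tmul a b => simp [evalFlip_apply]

theorem bijective_evalFlip_domRestrict_ker {D : Type*} [Ring D] [Algebra k D]
    [FiniteDimensional k D] {q : ConvDual k C →ₐ[k] D} {s : D →ₐ[k] ConvDual k C}
    {x : ConvDual k C} (hs : ∀ d, q (s d) = d) (hx : IsUniformizer q x)
    (hsurj : Function.Surjective (rightHit x)) :
    Function.Bijective ((evalFlip s.toLinearMap).domRestrict (LinearMap.ker (rightHit x))) := by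
  refine ⟨LinearMap.injective_domRestrict_iff.2
    (LinearMap.disjoint_ker.2 fun c hc hsc => ?_), fun φ => ?_⟩
  · refine eq_of_forall_ofConv_eq (k := k) fun a => ?_
    obtain ⟨b, hb⟩ := (hx.map_eq_zero_iff (a - s (q a))).1 (by rw [map_sub, hs, sub_self])
    rw [eq_add_of_sub_eq hb, map_zero, WithConv.ofConv_add, LinearMap.add_apply, ← ofConv_rightHit,
      LinearMap.mem_ker.1 hc, map_zero, zero_add]
    exact LinearMap.congr_fun hsc (q a)
  · by_contra hφ
    have hφ' : φ ∉ (LinearMap.ker (rightHit x)).map (evalFlip s.toLinearMap) := by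
      rintro ⟨c, hc, rfl⟩
      exact hφ ⟨⟨c, hc⟩, rfl⟩
    obtain ⟨f, hf, hfW⟩ := Submodule.exists_dual_map_eq_bot_of_notMem hφ' inferInstance
    obtain ⟨d, rfl⟩ := (Module.evalEquiv k D).surjective f
    have dvd : x ∣ s d := (dvd_iff_of_surjective_rightHit hsurj).2 fun c hc =>
      (Submodule.mem_bot k).1 (hfW ▸ Submodule.mem_map_of_mem (Submodule.mem_map_of_mem
        (LinearMap.mem_ker.2 hc)))
    have hd : d = 0 := by rw [← hs d, (hx.map_eq_zero_iff _).2 dvd]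
    exact hf (by rw [hd]; simp)

end Flip

section Bimodule

variable {D M : Type w} [Ring D] [Algebra k D] [FiniteDimensional k D] [AddCommGroup M]
  [Module k M] [Module D M] [Module Dᵐᵒᵖ M] [SMulCommClass D Dᵐᵒᵖ M] [IsScalarTower k D M]
  [IsScalarTower k Dᵐᵒᵖ M] [FiniteDimensional k M]
  {C : Type v} [AddCommGroup C] [Module k C] [Coalgebra k C]
  {s : D →ₐ[k] ConvDual k C} {f : M →ₗ[k] ConvDual k C}

/-- The bicolinear pair `C → D^*`, `C → M^*` dual to an algebra map `D → C^*` and a bimodule map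
`M → C^*`. -/
noncomputable def dualPair (hl : ∀ d m, f (d • m) = s d * f m)
    (hr : ∀ m d, f (MulOpposite.op d • m) = f m * s d) :
    BicolinearPair (dualBicomodule k D M) C where
  π := { evalFlip s.toLinearMap with
    counit_comp := LinearMap.ext fun c => by
      change (s 1).ofConv c = _
      rw [map_one, LinearMap.convOne_apply]
      rfl
    map_comp_comul := (dualSplit_comp_evalFlip fun x y => map_mul s x y).symm }
  g := evalFlip f
  left_comp_g := dualSplit_comp_evalFlip fun d m => by rw [leftAction_tmul, hl]; rfl
  right_comp_g := dualSplit_comp_evalFlip fun m d => by rw [rightAction_tmul, hr]; rfl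

theorem iterContract_power (hl : ∀ d m, f (d • m) = s d * f m)
    (hr : ∀ m d, f (MulOpposite.op d • m) = f m * s d) (e : M) (n : ℕ) (c : C) :
    iterContract k D e n (((dualPair hl hr).power n).1 c) =
      evalFlip s.toLinearMap ((rightHit (f e) ^ n) c) := by
  match n with
  | 0 => rfl
  | 1 =>
    refine LinearMap.ext fun d => ?_
    change (f (MulOpposite.op d • e)).ofConv c = (s d).ofConv ((rightHit (f e) ^ 1) c)
    rw [hr, pow_one, ofConv_rightHit]
  | n + 2 =>
    rw [pow_succ, Module.End.mul_apply, ← iterContract_power hl hr e (n + 1)]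
    exact congrArg (iterContract k D e (n + 1)) (contract_map_evalFlip f _ e c)

theorem nonempty_coalgEquiv_cotensorCoalgebra (hl : ∀ d m, f (d • m) = s d * f m)
    (hr : ∀ m d, f (MulOpposite.op d • m) = f m * s d) {e : M}
    (he : Function.Surjective fun d : D => MulOpposite.op d • e)
    (hsurj : Function.Surjective (rightHit (f e))) (hnil : ∀ c, ∃ n, (rightHit (f e) ^ n) c = 0)
    (hker : Function.Bijective
      ((evalFlip s.toLinearMap).domRestrict (LinearMap.ker (rightHit (f e))))) :
    Nonempty (C ≃ₗc[k] CotensorCoalgebra (dualBicomodule k D M)) := by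
  let P := dualPair hl hr
  have hP (n c) : iterContract k D e n ((P.power n).1 c) =
      evalFlip s.toLinearMap ((rightHit (f e) ^ n) c) := iterContract_power hl hr e n c
  have hfin (c) : {n | (P.power n).1 c ≠ 0}.Finite := by
    obtain ⟨N, hN⟩ := hnil c
    refine (Set.finite_lt_nat N).subset fun n hn => not_le.1 fun hNn : N ≤ n => hn ?_
    refine injective_iterContract he n ?_
    rw [hP, ← Nat.sub_add_cancel hNn, pow_add, Module.End.mul_apply, hN, map_zero, map_zero,
      map_zero]
  obtain ⟨F, hF⟩ := P.exists_proj_eq_power hfin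
  refine ⟨CoalgEquiv.ofBijective (f := F) ⟨(injective_iff_map_eq_zero F).2 fun c hc => ?_,
    fun t => ?_⟩⟩
  · refine eq_zero_of_forall_apply_pow_eq_zero (hnil c) hker.1 fun n => ?_
    rw [← hP, ← hF, hc, map_zero, map_zero]
  · obtain ⟨c, hc⟩ := exists_forall_apply_pow_eq
      (w := fun n => iterContract k D e n (CotensorCoalgebra.proj _ n t)) hsurj hker.2
      ((DFinsupp.finite_support t).subset fun n hn h => hn (by
        exact (congrArg (iterContract k D e n) h).trans (map_zero _)))
    refine ⟨c, CotensorCoalgebra.ext_proj fun n => injective_iterContract he n ?_⟩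
    rw [hF, hP, hc]

end Bimodule

/-- The map `D_α → C^*`, `d ↦ s(d) x`. -/
noncomputable def TwistedBimodule.mulRight {D A : Type*} [DivisionRing D] [Algebra k D] [Ring A]
    [Algebra k A] (α : D ≃ₐ[k] D) (s : D →ₐ[k] A) (x : A) : TwistedBimodule α →ₗ[k] A :=
  LinearMap.mulRight k x ∘ₗ s.toLinearMap

theorem nonempty_coalgEquiv_DC {D : Type w} [DivisionRing D] [Algebra k D] [FiniteDimensional k D]
    {C : Type v} [AddCommGroup C] [Module k C] [Coalgebra k C] {q : ConvDual k C →ₐ[k] D}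
    {s : D →ₐ[k] ConvDual k C} {x : ConvDual k C} {α : D ≃ₐ[k] D} (hs : ∀ d, q (s d) = d)
    (hx : IsUniformizer q x) (hα : ∀ d, x * s d = s (α d) * x)
    (hsurj : Function.Surjective (rightHit x)) (hnil : ∀ c, ∃ n, (rightHit x ^ n) c = 0) :
    Nonempty (C ≃ₗc[k] DC α) := by
  have mulRight_one : TwistedBimodule.mulRight α s x (TwistedBimodule.of α 1) = x := by
    change s 1 * x = x
    rw [map_one, one_mul]
  refine nonempty_coalgEquiv_cotensorCoalgebra (s := s) (f := TwistedBimodule.mulRight α s x)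
    (e := TwistedBimodule.of α 1) (fun a b : D => ?_) (fun a b : D => ?_)
    (fun d : D => ⟨α.symm d, ?_⟩) ?_ ?_ ?_
  · change s (a * b) * x = s a * (s b * x)
    rw [map_mul, mul_assoc]
  · change s (a * α b) * x = s a * x * s b
    rw [map_mul, mul_assoc, mul_assoc, hα]
  · change (1 : D) * α (α.symm d) = d
    rw [one_mul, α.apply_symm_apply]
  all_goals rw [mulRight_one]
  exacts [hsurj, hnil, bijective_evalFlip_domRestrict_ker hs hx hsurj]

end Recognition

end ChainCoalgebra

theorem mainTheorem7 {k : Type u} [Field k] [PerfectField k] {C : Type v} [AddCommGroup C]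
    [Module k C] [Coalgebra k C] (hC : ChainCoalgebra.IsChainCoalgebra k C)
    (hinf : ¬ FiniteDimensional k C) :
    ∃ (D : Type u) (_ : DivisionRing D) (_ : Algebra k D) (_ : FiniteDimensional k D)
      (α : D ≃ₐ[k] D), Nonempty (C ≃ₗc[k] ChainCoalgebra.DC α) := by
  obtain ⟨D, _, _, _, q, hqs, hq⟩ := hC.exists_algHom_residue hinf
  obtain ⟨x, hx⟩ := hC.exists_isUniformizer hinf hq
  obtain ⟨n, e, f, hef⟩ := ChainCoalgebra.exists_isSeparabilityIdempotent_of_perfectField k D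
  obtain ⟨s, hs⟩ :=
    ChainCoalgebra.exists_algHom_section hef hqs (hC.isAdicallyComplete_ker hinf hq)
  obtain ⟨α, u, hu, hα⟩ := hx.exists_twist hef hs
  have isUnit_u : IsUnit u := by
    by_contra h
    exact one_ne_zero (hu.symm.trans ((hq u).2 h))
  have hxu := hx.mul_isUnit isUnit_u
  have not_isUnit_xu : ¬ IsUnit (x * u) := (hq _).1 ((hxu.map_eq_zero_iff _).2 dvd_rfl)
  have := hC.isDomain_convDual hinf
  exact ⟨D, _, _, ‹_›, α, ChainCoalgebra.nonempty_coalgEquiv_DC hs hxu hα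
    (hC.surjective_rightHit hinf hxu.isLeftRegular.ne_zero)
    (hC.exists_pow_rightHit_eq_zero hinf not_isUnit_xu)⟩
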